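/- Let $H=L^2(\mathbb S^1,\mathbb C)$, $\mathbb S^1=\mathbb R/\mathbb Z$, with its Hermitian product $\langle\cdot,\cdot\rangle$, and let $\mathbb S^\infty_{L^2}=\{f\in H:\|f\|=1\}$, with $T_f\mathbb S^\infty_{L^2}=\{F\in H:\mathrm{Re}\langle f,F\rangle=0\}$, the metric $\mathcal G^{L^2}=\mathrm{Re}\langle\cdot,\cdot\rangle$ and the contact form $\alpha_f(F)=\tfrac12\mathrm{Re}\langle \mathrm i f,F\rangle$. On any submanifold of $H$ (and on the unit sphere of any complex linear subspace of $H$) we write $\mathcal G^{L^2}$ and $\mathrm d\alpha$ for the restrictions of the metric and of the magnetic field. A magnetomorphism $(M_1,g_1,\sigma_1)\to(M_2,g_2,\sigma_2)$ is a diffeomorphism $\Phi$ with $\Phi^*g_2=g_1$ and $\Phi^*\sigma_2=\sigma_1$; $\mathrm{Mag}(M,g,\sigma)$ is the group of magnetomorphisms of $(M,g,\sigma)$ to itself. A magnetic geodesic of $(M,g,\sigma)$ is a smooth curve with $\nabla_{\dot\gamma}\dot\gamma=Y_\gamma\dot\gamma$, where $\nabla$ is the Levi-Civita connection and $g(Yu,v)=\sigma(u,v)$.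 An embedded submanifold $N\subset M$ is totally magnetic if for every magnetic geodesic $\gamma$ of $M$ with $\gamma(0)\in N$ and $\dot\gamma(0)\in T_{\gamma(0)}N$ there is $\varepsilon>0$ with $\gamma((-\varepsilon,\varepsilon))\subset N$. (1) The group $\mathrm{Mag}(\mathbb S^\infty_{L^2},\mathcal G^{L^2},\mathrm d\alpha)$ is the group $\mathcal U_{L^2}$ of unitary operators of $H$: restricting unitary operators to the sphere is a group isomorphism $\mathcal U_{L^2}\to\mathrm{Mag}(\mathbb S^\infty_{L^2},\mathcal G^{L^2},\mathrm d\alpha)$. (2) Let $\lambda_{(f,F)}(\xi)=\mathcal G^{L^2}_f(F,\mathrm d\pi\,\xi)$ be the Liouville form on $T\mathbb S^\infty_{L^2}$, where $\pi\colon T\mathbb S^\infty_{L^2}\to\mathbb S^\infty_{L^2}$ is the projection. The twisted form $\omega_{\mathrm d\alpha}=\mathrm d\lambda-\pi^*\mathrm d\alpha$ is a (weak) symplectic form on $T\mathbb S^\infty_{L^2}$, and the lifted action $\Phi\cdot(f,F)=(\Phi(f),\mathrm d\Phi_fF)$ of the group in (1) is Hamiltonian with respect to it. Its moment map is $$\mu\colon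 T\mathbb S^\infty_{L^2}\to\mathfrak u^*,\qquad \mu(f,F)[A]=\mathcal G^{L^2}_f(Af,F)-\alpha_f(Af),\qquad A\in\mathfrak u,$$ where $\mathfrak u=\mathrm{Lie}(\mathcal U_{L^2})$ is the space of bounded skew-adjoint operators of $H$ and $\mathfrak u^*$ its topological dual. That is, the action is by symplectomorphisms, $\mu$ is smooth and equivariant for the coadjoint action, and $\mathrm d(\mu[A])=-\omega_{\mathrm d\alpha}(X_A,\cdot)$ for all $A\in\mathfrak u$, where $X_A$ is the vector field on $T\mathbb S^\infty_{L^2}$ that generates the action of $t\mapsto\exp(tA)$. (3) Let $N\subset\mathbb S^\infty_{L^2}$ be a topologically closed, connected, embedded smooth submanifold of positive (possibly infinite) dimension. Then $N$ is totally magnetic in $(\mathbb S^\infty_{L^2},\mathcal G^{L^2},\mathrm d\alpha)$ if and only if $N=\mathbb S^\infty_{L^2}\cap V$ for some complex linear subspace $V$ of $H$. Whenever $N=\mathbb S^\infty_{L^2}\cap V$ for a complex linear subspace $V$, the subspace $V$ is closed, hence a Hilbert space, and $(N,\mathcal G^{L^2},\mathrm d\alpha)$ is magnetomorphic to the unit sphere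 $(\mathbb S(V),\mathcal G^{L^2},\mathrm d\alpha)$ of $V$. -/

import Mathlib

open Set
open scoped ContDiff Topology

attribute [local instance] InnerProductSpace.complexToReal

noncomputable section

namespace Magnetic

/-! ## Submanifolds of a real Hilbert space

All manifolds below are smooth embedded submanifolds of a real Hilbert space, given as subsets.
The Riemannian metric is the one induced by the real inner product of the ambient space, and
differential forms are restrictions of forms on the ambient space. -/

section Submanifolds

variable {E : Type*} [NormedAddCommGroup E] [NormedSpace ℝ E]
variable {E' : Type*} [NormedAddCommGroup E'] [NormedSpace ℝ E']

/-- The tangent space `T_p M`: the velocities at `0` of the smooth curves that run in `M` and pass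
through `p` at time `0`. -/
def tangentVectors (M : Set E) (p : E) : Set E :=
  {u | ∃ ε > (0 : ℝ), ∃ c : ℝ → E, ContDiffOn ℝ ∞ c (Ioo (-ε) ε) ∧
    (∀ t ∈ Ioo (-ε) ε, c t ∈ M) ∧ c 0 = p ∧ deriv c 0 = u}

/-- The tangent bundle of `M`, as a subset of `E × E`. -/
def tangentBundle (M : Set E) : Set (E × E) :=
  {x | x.1 ∈ M ∧ x.2 ∈ tangentVectors M x.1}

/-- `N` is a smooth embedded submanifold: around each of its points there is a smooth chart of the
ambient space that straightens `N` to a closed linear subspace. (In a Hilbert space every closed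
subspace is complemented. The codimension may be infinite and the dimension too.) -/
def IsEmbeddedSubmanifold (N : Set E) : Prop :=
  ∀ p ∈ N, ∃ (χ : OpenPartialHomeomorph E E) (W : Submodule ℝ E),
    IsClosed (W : Set E) ∧ p ∈ χ.source ∧
    ContDiffOn ℝ ∞ χ χ.source ∧ ContDiffOn ℝ ∞ χ.symm χ.target ∧
    χ '' (χ.source ∩ N) = χ.target ∩ (W : Set E)

/-- `N` has positive dimension (at each of its points). -/
def HasPositiveDimension (N : Set E) : Prop :=
  ∀ p ∈ N, ∃ u ∈ tangentVectors N p, u ≠ 0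

/-- A map defined on `M` with values in the vector space `E'`, extended by `0` to the ambient
space of `M`. Only its behaviour within `M` is ever used. -/
def ambient {M : Set E} (φ : M → E') : E → E' :=
  Function.extend Subtype.val φ 0

/-- The ambient form of a map between submanifolds. -/
def ambientMap {M : Set E} {M' : Set E'} (φ : M → M') : E → E' :=
  ambient fun p => (φ p : E')

/-- The differential `dφ_p` of a map between submanifolds, to be applied to tangent vectors (on
these, the derivative within `M` does not depend on any choice). -/
def tangentMap {M : Set E} {M' : Set E'} (φ : M → M') (p : E) : E →L[ℝ] E' :=
  fderivWithin ℝ (ambientMap φ) M p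

/-- The lift `(p, u) ↦ (φ p, dφ_p u)` of a self-map of `M` to the tangent bundle. -/
def tangentLift {M : Set E} (φ : M → M) (x : E × E) : E × E :=
  (ambientMap φ x.1, tangentMap φ x.1 x.2)

/-- A field of linear functionals, as a differential 1-form. -/
def oneForm (θ : E → E →L[ℝ] ℝ) (x : E) : E [⋀^Fin 1]→L[ℝ] ℝ :=
  ContinuousAlternatingMap.ofSubsingleton ℝ E ℝ (0 : Fin 1) (θ x)

/-- The (restriction to `P` of the) 2-form `Ω` is a symplectic form on `P`: it is smooth, closed,
and (weakly) nondegenerate on the tangent spaces of `P`. -/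
structure IsSymplecticOn (P : Set E) (Ω : E → E [⋀^Fin 2]→L[ℝ] ℝ) : Prop where
  smooth : ContDiff ℝ ∞ Ω
  closed : ∀ x ∈ P, ∀ u ∈ tangentVectors P x, ∀ v ∈ tangentVectors P x,
    ∀ w ∈ tangentVectors P x, extDeriv Ω x ![u, v, w] = 0
  nondegenerate : ∀ x ∈ P, ∀ u ∈ tangentVectors P x,
    (∀ v ∈ tangentVectors P x, Ω x ![u, v] = 0) → u = 0

end Submanifolds

/-! ## Magnetic systems, magnetomorphisms, totally magnetic submanifolds -/

section MagneticSystems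

set_option linter.unusedSectionVars false

variable {E : Type*} [NormedAddCommGroup E] [InnerProductSpace ℝ E]
variable {E₁ : Type*} [NormedAddCommGroup E₁] [InnerProductSpace ℝ E₁]
variable {E₂ : Type*} [NormedAddCommGroup E₂] [InnerProductSpace ℝ E₂]
variable {E₃ : Type*} [NormedAddCommGroup E₃] [InnerProductSpace ℝ E₃]

/-- `y` is the Lorentz force `Y_q u` of the system `(M, g, σ)`: the tangent vector with
`g_q (Y_q u, v) = σ_q (u, v)` for all tangent vectors `v`. -/
def IsLorentzForce (M : Set E) (σ : E → E [⋀^Fin 2]→L[ℝ] ℝ) (q u y : E) : Prop :=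
  y ∈ tangentVectors M q ∧ ∀ v ∈ tangentVectors M q, inner ℝ y v = σ q ![u, v]

/-- `a` is the covariant acceleration `∇_{γ'} γ'` at time `t` of a curve `γ` in `M`, for the
Levi-Civita connection of the induced metric: the orthogonal projection of the ambient
acceleration `γ''(t)` to the tangent space of `M` at `γ t`. -/
def IsCovariantAcceleration (M : Set E) (γ : ℝ → E) (t : ℝ) (a : E) : Prop :=
  a ∈ tangentVectors M (γ t) ∧
    ∀ v ∈ tangentVectors M (γ t), inner ℝ (deriv (deriv γ) t - a) v = 0

/-- `γ` is, on the open interval `I`, a magnetic geodesic of `(M, g, σ)`: a smooth curve in `M`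
with `∇_{γ'} γ' = Y_γ γ'`. -/
structure IsMagneticGeodesicOn (M : Set E) (σ : E → E [⋀^Fin 2]→L[ℝ] ℝ) (γ : ℝ → E)
    (I : Set ℝ) : Prop where
  smooth : ContDiffOn ℝ ∞ γ I
  mem : ∀ t ∈ I, γ t ∈ M
  equation : ∀ t ∈ I, ∃ a : E, IsCovariantAcceleration M γ t a ∧
    IsLorentzForce M σ (γ t) (deriv γ t) a

/-- `N` is totally magnetic in `(M, g, σ)`: every magnetic geodesic of `M` that starts in `N` with
velocity tangent to `N` stays in `N` for a short time. -/
def IsTotallyMagnetic (M : Set E) (σ : E → E [⋀^Fin 2]→L[ℝ] ℝ) (N : Set E) : Prop :=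
  ∀ (I : Set ℝ) (γ : ℝ → E), IsOpen I → I.OrdConnected → (0 : ℝ) ∈ I →
    IsMagneticGeodesicOn M σ γ I → γ 0 ∈ N → deriv γ 0 ∈ tangentVectors N (γ 0) →
    ∃ ε > (0 : ℝ), Ioo (-ε) ε ⊆ I ∧ ∀ t ∈ Ioo (-ε) ε, γ t ∈ N

/-- A magnetomorphism `(M₁, g₁, σ₁) → (M₂, g₂, σ₂)`: a diffeomorphism `φ` with `φ^* g₂ = g₁` and
`φ^* σ₂ = σ₁`. -/
structure IsMagnetomorphism (M₁ : Set E₁) (σ₁ : E₁ → E₁ [⋀^Fin 2]→L[ℝ] ℝ)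
    (M₂ : Set E₂) (σ₂ : E₂ → E₂ [⋀^Fin 2]→L[ℝ] ℝ) (φ : M₁ ≃ M₂) : Prop where
  smooth : ContDiffOn ℝ ∞ (ambientMap φ) M₁
  smooth_symm : ContDiffOn ℝ ∞ (ambientMap φ.symm) M₂
  metric : ∀ p : M₁, ∀ u ∈ tangentVectors M₁ (p : E₁), ∀ v ∈ tangentVectors M₁ (p : E₁),
    inner ℝ (tangentMap φ p u) (tangentMap φ p v) = inner ℝ u v
  field : ∀ p : M₁, ∀ u ∈ tangentVectors M₁ (p : E₁), ∀ v ∈ tangentVectors M₁ (p : E₁),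
    σ₂ (φ p) ![tangentMap φ p u, tangentMap φ p v] = σ₁ p ![u, v]

/-- The two magnetic systems are magnetomorphic. -/
def Magnetomorphic (M₁ : Set E₁) (σ₁ : E₁ → E₁ [⋀^Fin 2]→L[ℝ] ℝ)
    (M₂ : Set E₂) (σ₂ : E₂ → E₂ [⋀^Fin 2]→L[ℝ] ℝ) : Prop :=
  ∃ φ : M₁ ≃ M₂, IsMagnetomorphism M₁ σ₁ M₂ σ₂ φ

/-! The facts needed to see that the magnetomorphisms of a system form a group. -/

theorem ambientMap_apply {M₁ : Set E₁} {M₂ : Set E₂} (φ : M₁ → M₂) (p : M₁) :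
    ambientMap φ (p : E₁) = φ p := by
  simp [ambientMap, ambient]

theorem mapsTo_ambientMap {M₁ : Set E₁} {M₂ : Set E₂} (φ : M₁ → M₂) :
    MapsTo (ambientMap φ) M₁ M₂ := by
  intro x hx
  rw [ambientMap_apply φ ⟨x, hx⟩]
  exact (φ ⟨x, hx⟩).2

theorem eqOn_ambientMap_comp {M₁ : Set E₁} {M₂ : Set E₂} {M₃ : Set E₃}
    (ψ : M₂ → M₃) (φ : M₁ → M₂) :
    EqOn (ambientMap (fun p => ψ (φ p))) (ambientMap ψ ∘ ambientMap φ) M₁ := by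
  intro x hx
  rw [ambientMap_apply _ ⟨x, hx⟩, Function.comp_apply, ambientMap_apply φ ⟨x, hx⟩,
    ambientMap_apply ψ]

theorem contDiffOn_ambientMap_comp {M₁ : Set E₁} {M₂ : Set E₂} {M₃ : Set E₃}
    {ψ : M₂ → M₃} {φ : M₁ → M₂} (hψ : ContDiffOn ℝ ∞ (ambientMap ψ) M₂)
    (hφ : ContDiffOn ℝ ∞ (ambientMap φ) M₁) :
    ContDiffOn ℝ ∞ (ambientMap (fun p => ψ (φ p))) M₁ :=
  (hψ.comp hφ (mapsTo_ambientMap φ)).congr (eqOn_ambientMap_comp ψ φ)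

/-- Differentiating `φ` along a curve in `M₁`. -/
theorem curve_comp {M₁ : Set E₁} {M₂ : Set E₂} {φ : M₁ → M₂}
    (hφ : ContDiffOn ℝ ∞ (ambientMap φ) M₁) (p : M₁) {ε : ℝ} (hε : 0 < ε) {c : ℝ → E₁}
    (hc : ContDiffOn ℝ ∞ c (Ioo (-ε) ε)) (hM : ∀ t ∈ Ioo (-ε) ε, c t ∈ M₁) (h0 : c 0 = p) :
    deriv (ambientMap φ ∘ c) 0 = tangentMap φ p (deriv c 0) := by
  have h0mem : (0 : ℝ) ∈ Ioo (-ε) ε := by constructor <;> linarith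
  have hn : Ioo (-ε) ε ∈ 𝓝 (0 : ℝ) := isOpen_Ioo.mem_nhds h0mem
  have hd : HasDerivWithinAt c (deriv c 0) (Ioo (-ε) ε) 0 :=
    ((hc.contDiffAt hn).differentiableAt (by simp)).hasDerivAt.hasDerivWithinAt
  have hf : HasFDerivWithinAt (ambientMap φ) (tangentMap φ p) M₁ (c 0) := by
    rw [h0]
    exact (hφ.differentiableOn (by simp) p p.2).hasFDerivWithinAt
  exact ((hf.comp_hasDerivWithinAt (0 : ℝ) hd hM).hasDerivAt hn).deriv

theorem tangentMap_mem {M₁ : Set E₁} {M₂ : Set E₂} {φ : M₁ → M₂}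
    (hφ : ContDiffOn ℝ ∞ (ambientMap φ) M₁) (p : M₁) {u : E₁}
    (hu : u ∈ tangentVectors M₁ (p : E₁)) :
    tangentMap φ p u ∈ tangentVectors M₂ (φ p : E₂) := by
  obtain ⟨ε, hε, c, hc, hM, h0, rfl⟩ := hu
  refine ⟨ε, hε, ambientMap φ ∘ c, hφ.comp hc hM,
    fun t ht => mapsTo_ambientMap φ (hM t ht), ?_, curve_comp hφ p hε hc hM h0⟩
  rw [Function.comp_apply, h0, ambientMap_apply]

theorem tangentMap_comp {M₁ : Set E₁} {M₂ : Set E₂} {M₃ : Set E₃} {ψ : M₂ → M₃} {φ : M₁ → M₂}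
    (hψ : ContDiffOn ℝ ∞ (ambientMap ψ) M₂) (hφ : ContDiffOn ℝ ∞ (ambientMap φ) M₁)
    (p : M₁) {u : E₁} (hu : u ∈ tangentVectors M₁ (p : E₁)) :
    tangentMap (fun p => ψ (φ p)) p u = tangentMap ψ (φ p) (tangentMap φ p u) := by
  obtain ⟨ε, hε, c, hc, hM, h0, rfl⟩ := hu
  have hc' : ContDiffOn ℝ ∞ (ambientMap φ ∘ c) (Ioo (-ε) ε) := hφ.comp hc hM
  have hM' : ∀ t ∈ Ioo (-ε) ε, (ambientMap φ ∘ c) t ∈ M₂ :=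
    fun t ht => mapsTo_ambientMap φ (hM t ht)
  have h0' : (ambientMap φ ∘ c) 0 = φ p := by
    rw [Function.comp_apply, h0, ambientMap_apply]
  rw [← curve_comp (contDiffOn_ambientMap_comp hψ hφ) p hε hc hM h0,
    ← curve_comp hφ p hε hc hM h0, ← curve_comp hψ (φ p) hε hc' hM' h0']
  have h0mem : (0 : ℝ) ∈ Ioo (-ε) ε := by constructor <;> linarith
  apply Filter.EventuallyEq.deriv_eq
  filter_upwards [isOpen_Ioo.mem_nhds h0mem] with t ht
  exact eqOn_ambientMap_comp ψ φ (hM t ht)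

theorem tangentMap_id {M : Set E} (p : M) {u : E} (hu : u ∈ tangentVectors M (p : E)) :
    tangentMap (fun q : M => q) p u = u := by
  have hE : EqOn (ambientMap (fun q : M => q)) id M := fun x hx =>
    ambientMap_apply (fun q : M => q) ⟨x, hx⟩
  have hs : ContDiffOn ℝ ∞ (ambientMap (fun q : M => q)) M := contDiffOn_id.congr hE
  obtain ⟨ε, hε, c, hc, hM, h0, rfl⟩ := hu
  rw [← curve_comp hs p hε hc hM h0]
  have h0mem : (0 : ℝ) ∈ Ioo (-ε) ε := by constructor <;> linarith
  apply Filter.EventuallyEq.deriv_eq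
  filter_upwards [isOpen_Ioo.mem_nhds h0mem] with t ht
  exact hE (hM t ht)

theorem IsMagnetomorphism.refl (M : Set E) (σ : E → E [⋀^Fin 2]→L[ℝ] ℝ) :
    IsMagnetomorphism M σ M σ (Equiv.refl M) := by
  have hE : EqOn (ambientMap (fun q : M => q)) id M := fun x hx =>
    ambientMap_apply (fun q : M => q) ⟨x, hx⟩
  have hs : ContDiffOn ℝ ∞ (ambientMap (fun q : M => q)) M := contDiffOn_id.congr hE
  refine ⟨hs, hs, fun p u hu v hv => ?_, fun p u hu v hv => ?_⟩
  · change inner ℝ (tangentMap (fun q : M => q) p u) (tangentMap (fun q : M => q) p v) = _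
    rw [tangentMap_id p hu, tangentMap_id p hv]
  · change σ p ![tangentMap (fun q : M => q) p u, tangentMap (fun q : M => q) p v] = _
    rw [tangentMap_id p hu, tangentMap_id p hv]

theorem IsMagnetomorphism.trans {M₁ : Set E₁} {σ₁ : E₁ → E₁ [⋀^Fin 2]→L[ℝ] ℝ}
    {M₂ : Set E₂} {σ₂ : E₂ → E₂ [⋀^Fin 2]→L[ℝ] ℝ} {M₃ : Set E₃} {σ₃ : E₃ → E₃ [⋀^Fin 2]→L[ℝ] ℝ}
    {φ : M₁ ≃ M₂} {ψ : M₂ ≃ M₃} (hφ : IsMagnetomorphism M₁ σ₁ M₂ σ₂ φ)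
    (hψ : IsMagnetomorphism M₂ σ₂ M₃ σ₃ ψ) :
    IsMagnetomorphism M₁ σ₁ M₃ σ₃ (φ.trans ψ) := by
  refine ⟨contDiffOn_ambientMap_comp (ψ := ψ) (φ := φ) hψ.smooth hφ.smooth,
    contDiffOn_ambientMap_comp (ψ := φ.symm) (φ := ψ.symm) hφ.smooth_symm hψ.smooth_symm,
    fun p u hu v hv => ?_, fun p u hu v hv => ?_⟩
  · change inner ℝ (tangentMap (fun q => ψ (φ q)) p u) (tangentMap (fun q => ψ (φ q)) p v) = _
    rw [tangentMap_comp hψ.smooth hφ.smooth p hu, tangentMap_comp hψ.smooth hφ.smooth p hv,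
      hψ.metric (φ p) _ (tangentMap_mem hφ.smooth p hu) _ (tangentMap_mem hφ.smooth p hv),
      hφ.metric p u hu v hv]
  · change σ₃ (ψ (φ p))
      ![tangentMap (fun q => ψ (φ q)) p u, tangentMap (fun q => ψ (φ q)) p v] = _
    rw [tangentMap_comp hψ.smooth hφ.smooth p hu, tangentMap_comp hψ.smooth hφ.smooth p hv,
      hψ.field (φ p) _ (tangentMap_mem hφ.smooth p hu) _ (tangentMap_mem hφ.smooth p hv),
      hφ.field p u hu v hv]

theorem IsMagnetomorphism.symm {M₁ : Set E₁} {σ₁ : E₁ → E₁ [⋀^Fin 2]→L[ℝ] ℝ}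
    {M₂ : Set E₂} {σ₂ : E₂ → E₂ [⋀^Fin 2]→L[ℝ] ℝ} {φ : M₁ ≃ M₂}
    (hφ : IsMagnetomorphism M₁ σ₁ M₂ σ₂ φ) :
    IsMagnetomorphism M₂ σ₂ M₁ σ₁ φ.symm := by
  have key : ∀ (q : M₂) (u : E₂), u ∈ tangentVectors M₂ (q : E₂) →
      tangentMap φ (φ.symm q : E₁) (tangentMap φ.symm q u) = u := by
    intro q u hu
    have h := tangentMap_comp hφ.smooth hφ.smooth_symm q hu
    simp only [Equiv.apply_symm_apply] at h
    rw [← h, tangentMap_id q hu]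
  refine ⟨hφ.smooth_symm, hφ.smooth, fun q u hu v hv => ?_, fun q u hu v hv => ?_⟩
  · rw [← hφ.metric (φ.symm q) _ (tangentMap_mem hφ.smooth_symm q hu) _
      (tangentMap_mem hφ.smooth_symm q hv), key q u hu, key q v hv]
  · rw [← hφ.field (φ.symm q) _ (tangentMap_mem hφ.smooth_symm q hu) _
      (tangentMap_mem hφ.smooth_symm q hv), key q u hu, key q v hv, Equiv.apply_symm_apply]

/-- The group `Mag(M, g, σ)` of magnetomorphisms of a magnetic system (under composition). -/
def magGroup (M : Set E) (σ : E → E [⋀^Fin 2]→L[ℝ] ℝ) : Subgroup (Equiv.Perm M) where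
  carrier := {φ | IsMagnetomorphism M σ M σ φ}
  one_mem' := IsMagnetomorphism.refl M σ
  mul_mem' := fun hφ hψ => hψ.trans hφ
  inv_mem' := fun hφ => hφ.symm

/-- The Liouville 1-form on the tangent bundle (the metric pullback of the canonical 1-form of the
cotangent bundle): `λ_{(q, v)} ξ = g_q (v, dπ ξ)`, where `π (q, v) = q`. -/
def liouvilleForm (x : E × E) : (E × E) →L[ℝ] ℝ :=
  (innerSL ℝ x.2).comp (ContinuousLinearMap.fst ℝ E E)

/-- The twisted 2-form `ω_σ = dλ - π^* σ` on the tangent bundle. -/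
def twistedForm (σ : E → E [⋀^Fin 2]→L[ℝ] ℝ) (x : E × E) : (E × E) [⋀^Fin 2]→L[ℝ] ℝ :=
  extDeriv (oneForm liouvilleForm) x -
    (σ x.1).compContinuousLinearMap (ContinuousLinearMap.fst ℝ E E)

end MagneticSystems

/-! ## The unit sphere of a complex Hilbert space

The real inner product of a complex inner product space is `Re ⟨·, ·⟩`. -/

section Sphere

variable (H : Type*) [NormedAddCommGroup H] [InnerProductSpace ℂ H]

/-- The unit sphere. -/
def unitSphere : Set H := Metric.sphere (0 : H) 1

/-- The standard contact form `α_f F = ½ Re ⟨i f, F⟩`. -/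
def contactForm (f : H) : H →L[ℝ] ℝ :=
  (1 / 2 : ℝ) • innerSL ℝ (Complex.I • f)

/-- The magnetic field `dα`. -/
def dContactForm : H → H [⋀^Fin 2]→L[ℝ] ℝ :=
  extDeriv (oneForm (contactForm H))

end Sphere

/-! ## The unitary group and moment maps -/

section Hamiltonian

variable (H : Type*) [NormedAddCommGroup H] [InnerProductSpace ℂ H] [CompleteSpace H]

/-- The group of unitary operators of `H`. -/
abbrev UnitaryGroup : Type _ := unitary (H →L[ℂ] H)

/-- Its Lie algebra: the real Banach space of skew-adjoint bounded operators. -/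
abbrev UnitaryLieAlgebra : Type _ := skewAdjoint.submodule ℝ (H →L[ℂ] H)

variable {H}

/-- The exponential map of the unitary group. -/
def unitaryExp (A : UnitaryLieAlgebra H) : UnitaryGroup H :=
  ⟨NormedSpace.exp (A : H →L[ℂ] H),
    letI : NormedAlgebra ℚ (H →L[ℂ] H) := .restrictScalars ℚ ℂ (H →L[ℂ] H)
    NormedSpace.exp_mem_unitary_of_mem_skewAdjoint A.2⟩

/-- The adjoint representation `Ad_U A = U A U⁻¹` of the unitary group. -/
def unitaryAd (U : UnitaryGroup H) (A : UnitaryLieAlgebra H) : UnitaryLieAlgebra H :=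
  ⟨(U : H →L[ℂ] H) * A * star (U : H →L[ℂ] H), skewAdjoint.conjugate A.2 _⟩

/-- `ρ` restricts to an action of the unitary group on `P` by symplectomorphisms of `(P, Ω)`, and
this action is Hamiltonian with moment map `μ`: with `X_A` the fundamental vector field of `A`, the
function `x ↦ μ x A` satisfies `d(μ A) = - Ω (X_A, ·)`, and `μ` is equivariant for the coadjoint
action. (The sign is the one for which the flow of magnetic geodesics is the Hamiltonian flow of
the kinetic energy with respect to `dλ - π^* σ`.) -/
structure IsHamiltonianAction {Q : Type*} [NormedAddCommGroup Q] [NormedSpace ℝ Q]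
    (P : Set Q) (Ω : Q → Q [⋀^Fin 2]→L[ℝ] ℝ) (ρ : UnitaryGroup H → Q → Q)
    (μ : Q → (UnitaryLieAlgebra H →L[ℝ] ℝ)) : Prop where
  mapsTo : ∀ U, MapsTo (ρ U) P P
  one_act : ∀ x ∈ P, ρ 1 x = x
  mul_act : ∀ U U', ∀ x ∈ P, ρ (U * U') x = ρ U (ρ U' x)
  smooth_act : ∀ U, ContDiffOn ℝ ∞ (ρ U) P
  symplectic : ∀ U, ∀ x ∈ P, ∀ u ∈ tangentVectors P x, ∀ v ∈ tangentVectors P x,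
    Ω (ρ U x) ![fderivWithin ℝ (ρ U) P x u, fderivWithin ℝ (ρ U) P x v] = Ω x ![u, v]
  smooth_moment : ContDiffOn ℝ ∞ μ P
  hamiltonian : ∀ A : UnitaryLieAlgebra H, ∀ x ∈ P, ∃ X ∈ tangentVectors P x,
    HasDerivAt (fun t : ℝ => ρ (unitaryExp (t • A)) x) X 0 ∧
    ∀ w ∈ tangentVectors P x, fderivWithin ℝ μ P x w A = - Ω x ![X, w]
  equivariant : ∀ U, ∀ x ∈ P, ∀ A : UnitaryLieAlgebra H,
    μ (ρ U x) A = μ x (unitaryAd U⁻¹ A)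

end Hamiltonian

/-- The complex Hilbert space `L²(S¹, ℂ)`, where `S¹ = ℝ / ℤ`. (A definition, so that its only
real inner product is `Re ⟨·, ·⟩`.) -/
def L2Circle : Type :=
  MeasureTheory.Lp ℂ 2 (MeasureTheory.volume : MeasureTheory.Measure UnitAddCircle)

instance : NormedAddCommGroup L2Circle :=
  inferInstanceAs (NormedAddCommGroup
    (MeasureTheory.Lp ℂ 2 (MeasureTheory.volume : MeasureTheory.Measure UnitAddCircle)))

instance : InnerProductSpace ℂ L2Circle :=
  inferInstanceAs (InnerProductSpace ℂ
    (MeasureTheory.Lp ℂ 2 (MeasureTheory.volume : MeasureTheory.Measure UnitAddCircle)))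

instance : CompleteSpace L2Circle :=
  inferInstanceAs (CompleteSpace
    (MeasureTheory.Lp ℂ 2 (MeasureTheory.volume : MeasureTheory.Measure UnitAddCircle)))

end Magnetic

end

/-!
The three parts rest on explicit formulas on the unit sphere `S` of a complex Hilbert space. There
`dα (u, v) = Re ⟨i u, v⟩` is a constant form, and `T_p S` is the real orthogonal complement of `p`.

*Magnetomorphisms.* A magnetomorphism `φ` maps great circles to curves of unit speed. A unit-speed
curve cannot leave its starting point faster than a great circle (`cos_le_inner_of_unit_speed`), so
`Re ⟨φ p, φ q⟩ ≥ Re ⟨p, q⟩`; the inverse map gives equality. Hence `φ` extends to a real-linear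
isometry, equal to its own differential, and preservation of `dα` forces it to commute with `i`
(`IsMagnetomorphism.commute_I`). The last step needs complex dimension at least two.

*Moment map.* The twisted form is constant on `H × H`, and on the tangent bundle of `S` everything
is the restriction of linear or quadratic maps of `H × H`. The identity
`d (μ A) = - ω (X_A, ·)` is then a computation with skew-adjoint operators
(`fderiv_momentMap_eq_neg_twistedForm`).

*Totally magnetic submanifolds.* A curve in `S` is a magnetic geodesic exactly when
`γ'' = i γ' + k γ` with a real function `k`. The solutions are the curves
`e^{i t / 2} (cos (a t) p + sin (a t) w)` (`magneticCurve`). Let `N` be closed, totally magnetic and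
of positive dimension. Geodesics tangent to `N` stay in `N` for all times. Comparing the
accelerations of geodesics with proportional velocities shows that `T_p N` is invariant under the
Lorentz force (`IsTotallyMagnetic.lorentz_mem`). Rotating the initial velocity of a geodesic shows
that `i p` is tangent to `N` (`IsTotallyMagnetic.reeb_mem`). Hence `N` is invariant under phases,
because the orbits `t ↦ e^{i t} p` are geodesics as well, and removing the phase from
`magneticCurve` shows that `N` contains the great circles tangent to it. So `N` contains the unit
sphere of the complex space `V_p = ℝ p ⊕ T_p N`. By the inverse function theorem `N` agrees near
each point `q` with the unit sphere of `V_q`, which is `V_p` whenever `q ∈ V_p`, and connectedness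
gives `N = S ∩ V_p`. Conversely, the component of a magnetic geodesic orthogonal to a closed complex
subspace solves a homogeneous linear equation (`isTotallyMagnetic_inter`).
-/

namespace Magnetic

/-! ### Tangent vectors and derivatives within a set -/

section General

variable {E : Type*} [NormedAddCommGroup E] [NormedSpace ℝ E]
variable {E' : Type*} [NormedAddCommGroup E'] [NormedSpace ℝ E']

theorem deriv_mem_tangentVectors {M : Set E} {c : ℝ → E} (hc : ContDiff ℝ ∞ c)
    (hM : ∀ t, c t ∈ M) (t : ℝ) : deriv c t ∈ tangentVectors M (c t) := by
  refine ⟨1, one_pos, fun s => c (s + t), ?_, fun s _ => hM _, by simp, ?_⟩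
  · exact (hc.comp (contDiff_id.add contDiff_const)).contDiffOn
  · rw [deriv_comp_add_const]; simp

theorem exists_hasDerivAt_comp_of_mem_tangentVectors {M : Set E} {p u : E}
    (hu : u ∈ tangentVectors M p) {g : E → E'} {g' : E →L[ℝ] E'}
    (hg : HasFDerivWithinAt g g' M p) :
    ∃ ε > (0 : ℝ), ∃ c : ℝ → E, ContDiffOn ℝ ∞ c (Ioo (-ε) ε) ∧ (∀ t ∈ Ioo (-ε) ε, c t ∈ M) ∧
      c 0 = p ∧ HasDerivAt c u 0 ∧ HasDerivAt (g ∘ c) (g' u) 0 := by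
  obtain ⟨ε, hε, c, hc, hM, h0, rfl⟩ := hu
  have hn : Ioo (-ε) ε ∈ 𝓝 (0 : ℝ) := isOpen_Ioo.mem_nhds ⟨by linarith, hε⟩
  have hd : HasDerivAt c (deriv c 0) 0 :=
    ((hc.contDiffAt hn).differentiableAt (by simp)).hasDerivAt
  refine ⟨ε, hε, c, hc, hM, h0, hd, ?_⟩
  subst h0
  exact (hg.comp_hasDerivWithinAt (0 : ℝ) hd.hasDerivWithinAt hM).hasDerivAt hn

/-- On tangent vectors the derivative within `M` is determined: it is the derivative along curves
in `M`, whether or not derivatives within `M` are unique. -/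
theorem fderivWithin_apply_of_mem_tangentVectors {M : Set E} {p u : E}
    (hu : u ∈ tangentVectors M p) {g : E → E'} {g' : E →L[ℝ] E'}
    (hg : HasFDerivWithinAt g g' M p) : fderivWithin ℝ g M p u = g' u := by
  obtain ⟨ε, hε, c, hc, hM, h0, hd, h1⟩ := exists_hasDerivAt_comp_of_mem_tangentVectors hu hg
  have hn : Ioo (-ε) ε ∈ 𝓝 (0 : ℝ) := isOpen_Ioo.mem_nhds ⟨by linarith, hε⟩
  subst h0
  have h2 := (hg.differentiableWithinAt.hasFDerivWithinAt.comp_hasDerivWithinAt (0 : ℝ)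
    hd.hasDerivWithinAt hM).hasDerivAt hn
  exact h2.unique h1

/-- A map that agrees with a bounded linear map on `M` has that map as its differential. -/
theorem fderivWithin_apply_of_eqOn {M : Set E} {p u : E} (hp : p ∈ M)
    (hu : u ∈ tangentVectors M p) {g : E → E'} (L : E →L[ℝ] E') (hg : EqOn g L M) :
    fderivWithin ℝ g M p u = L u :=
  fderivWithin_apply_of_mem_tangentVectors hu
    (L.hasFDerivAt.hasFDerivWithinAt.congr hg (hg hp))

/-- The derivative of a map that is constant on `M` vanishes on the tangent vectors of `M`. -/
theorem apply_eq_zero_of_mem_tangentVectors {M : Set E} {p u : E}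
    (hu : u ∈ tangentVectors M p) {g : E → E'} {g' : E →L[ℝ] E'}
    (hg : HasFDerivWithinAt g g' M p) (h0 : ∀ x ∈ M, g x = g p) : g' u = 0 := by
  rw [← fderivWithin_apply_of_mem_tangentVectors hu hg]
  have : HasFDerivWithinAt g (0 : E →L[ℝ] E') M p :=
    (hasFDerivWithinAt_const (g p) p M).congr h0 rfl
  simpa using fderivWithin_apply_of_mem_tangentVectors hu this

theorem tangentVectors_mono {M M' : Set E} (h : M ⊆ M') (p : E) :
    tangentVectors M p ⊆ tangentVectors M' p := by
  rintro u ⟨ε, hε, c, hc, hM, h0, h1⟩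
  exact ⟨ε, hε, c, hc, fun t ht => h (hM t ht), h0, h1⟩

theorem mem_tangentVectors_of_hasDerivAt {M : Set E} {p u : E} {c : ℝ → E} (hc : ContDiff ℝ ∞ c)
    (hM : ∀ t, c t ∈ M) (h0 : c 0 = p) (h1 : HasDerivAt c u 0) : u ∈ tangentVectors M p := by
  have := deriv_mem_tangentVectors hc hM 0
  rwa [h0, h1.deriv] at this

/-- Functionals as alternating 1-forms, linearly. -/
noncomputable def oneFormCLM (E : Type*) [NormedAddCommGroup E] [NormedSpace ℝ E] :
    (E →L[ℝ] ℝ) →L[ℝ] E [⋀^Fin 1]→L[ℝ] ℝ :=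
  (ContinuousAlternatingMap.ofSubsingletonLIE (𝕜 := ℝ) (E := E) (F := ℝ)
    (0 : Fin 1)).toContinuousLinearEquiv.toContinuousLinearMap

theorem hasFDerivAt_oneForm_linear (T : E →L[ℝ] E →L[ℝ] ℝ) (x : E) :
    HasFDerivAt (oneForm fun y => T y) ((oneFormCLM E).comp T) x :=
  ((oneFormCLM E).comp T).hasFDerivAt

theorem extDeriv_linear_apply (T : E →L[ℝ] E →L[ℝ] ℝ) (x u v : E) :
    extDeriv (oneForm fun y => T y) x ![u, v] = T u v - T v u := by
  rw [extDeriv, (hasFDerivAt_oneForm_linear T x).fderiv,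
    ContinuousAlternatingMap.alternatizeUncurryFin_apply]
  simp [Fin.sum_univ_two, oneFormCLM, ContinuousAlternatingMap.ofSubsingletonLIE]
  rfl

theorem exists_extDeriv_linear_eq_const (T : E →L[ℝ] E →L[ℝ] ℝ) :
    ∃ Ω, extDeriv (oneForm fun y => T y) = fun _ => Ω :=
  ⟨_, funext fun x => by rw [extDeriv, (hasFDerivAt_oneForm_linear T x).fderiv]⟩

end General

/-! ### The unit sphere, its contact form and its great circles -/

section Sphere

variable {H : Type*} [NormedAddCommGroup H] [InnerProductSpace ℂ H]

theorem complex_smul_eq (z : ℂ) (x : H) : z • x = z.re • x + z.im • Complex.I • x := by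
  conv_lhs => rw [← Complex.re_add_im z, add_smul, mul_smul]
  rfl

theorem inner_I_smul_left_eq_neg (u v : H) :
    inner ℝ (Complex.I • u) v = -inner ℝ u (Complex.I • v) := by
  rw [real_inner_eq_re_inner ℂ, real_inner_eq_re_inner ℂ]
  simp [inner_smul_left, inner_smul_right]

theorem inner_I_smul_I_smul (u v : H) :
    inner ℝ (Complex.I • u) (Complex.I • v) = inner ℝ u v := by
  rw [inner_I_smul_left_eq_neg, smul_smul]; simp

theorem inner_self_I_smul (u : H) : inner ℝ u (Complex.I • u) = 0 := by
  have h := inner_I_smul_left_eq_neg u u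
  rw [real_inner_comm] at h
  linarith

theorem mem_unitSphere {H : Type*} [NormedAddCommGroup H] {p : H} : p ∈ unitSphere H ↔ ‖p‖ = 1 := by
  simp [unitSphere]

theorem inner_self_of_mem_unitSphere {p : H} (hp : p ∈ unitSphere H) : inner ℝ p p = 1 := by
  rw [real_inner_self_eq_norm_sq, mem_unitSphere.1 hp]; norm_num

theorem mem_unitSphere_iff_inner {p : H} : p ∈ unitSphere H ↔ inner ℝ p p = 1 := by
  refine ⟨inner_self_of_mem_unitSphere, fun h => ?_⟩
  rw [real_inner_self_eq_norm_sq] at h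
  exact mem_unitSphere.2 (by nlinarith [norm_nonneg p])

theorem contactForm_eq (f F : H) : contactForm H f F = 1 / 2 * inner ℝ (Complex.I • f) F := rfl

/-- The contact form, as a continuous linear map into the dual space. -/
noncomputable def contactCLM (H : Type*) [NormedAddCommGroup H] [InnerProductSpace ℂ H] :
    H →L[ℝ] H →L[ℝ] ℝ :=
  (1 / 2 : ℝ) • (innerSL ℝ).comp (Complex.I • ContinuousLinearMap.id ℝ H)

theorem dContactForm_apply (x u v : H) :
    dContactForm H x ![u, v] = inner ℝ (Complex.I • u) v := by
  have : contactForm H = fun y => contactCLM H y := rfl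
  rw [dContactForm, this, extDeriv_linear_apply]
  simp only [← this, contactForm_eq]
  rw [inner_I_smul_left_eq_neg v u, real_inner_comm]; ring

theorem dContactForm_const : ∃ Ω, dContactForm H = fun _ => Ω :=
  exists_extDeriv_linear_eq_const (contactCLM H)

/-- The curve `cos t p + sin t w`. It is a great circle when `p` and `w` are orthonormal. -/
noncomputable def greatCircle (p w : H) (t : ℝ) : H := Real.cos t • p + Real.sin t • w

theorem hasDerivAt_greatCircle (p w : H) (t : ℝ) :
    HasDerivAt (greatCircle p w) (-Real.sin t • p + Real.cos t • w) t :=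
  ((Real.hasDerivAt_cos t).smul_const p).add ((Real.hasDerivAt_sin t).smul_const w)

theorem contDiff_greatCircle (p w : H) : ContDiff ℝ ∞ (greatCircle p w) :=
  (Real.contDiff_cos.smul contDiff_const).add (Real.contDiff_sin.smul contDiff_const)

@[simp] theorem greatCircle_zero (p w : H) : greatCircle p w 0 = p := by simp [greatCircle]

theorem inner_cos_sin {p w : H} (hp : p ∈ unitSphere H) (hw : w ∈ unitSphere H)
    (hpw : inner ℝ p w = 0) (a b c d : ℝ) :
    inner ℝ (a • p + b • w) (c • p + d • w) = a * c + b * d := by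
  have hwp : inner ℝ w p = 0 := by rw [real_inner_comm]; exact hpw
  simp only [inner_add_left, inner_add_right, real_inner_smul_left, real_inner_smul_right,
    inner_self_of_mem_unitSphere hp, inner_self_of_mem_unitSphere hw, hpw, hwp]
  ring

theorem greatCircle_mem {p w : H} (hp : p ∈ unitSphere H) (hw : w ∈ unitSphere H)
    (hpw : inner ℝ p w = 0) (t : ℝ) : greatCircle p w t ∈ unitSphere H := by
  rw [mem_unitSphere_iff_inner, greatCircle, inner_cos_sin hp hw hpw, ← pow_two, ← pow_two]
  exact Real.cos_sq_add_sin_sq t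

theorem norm_deriv_greatCircle {p w : H} (hp : p ∈ unitSphere H) (hw : w ∈ unitSphere H)
    (hpw : inner ℝ p w = 0) (t : ℝ) : ‖-Real.sin t • p + Real.cos t • w‖ = 1 := by
  rw [← mem_unitSphere, mem_unitSphere_iff_inner, inner_cos_sin hp hw hpw]
  nlinarith [Real.cos_sq_add_sin_sq t]

/-- A vector orthogonal to a unit vector `p` is a multiple of a unit vector orthogonal to `p`. -/
theorem exists_unit_smul_eq {p u : H} (hp : p ∈ unitSphere H) (hu : inner ℝ p u = 0) :
    ∃ w ∈ unitSphere H, inner ℝ p w = 0 ∧ ∃ a : ℝ, 0 ≤ a ∧ u = a • w := by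
  by_cases h : u = 0
  · refine ⟨Complex.I • p, ?_, inner_self_I_smul p, 0, le_rfl, by simp [h]⟩
    rw [mem_unitSphere_iff_inner, inner_I_smul_I_smul, inner_self_of_mem_unitSphere hp]
  · have h' : ‖u‖ ≠ 0 := norm_ne_zero_iff.2 h
    refine ⟨‖u‖⁻¹ • u, ?_, ?_, ‖u‖, norm_nonneg u, by rw [smul_smul, mul_inv_cancel₀ h', one_smul]⟩
    · rw [mem_unitSphere, norm_smul, norm_inv, norm_norm, inv_mul_cancel₀ h']
    · rw [real_inner_smul_right, hu, mul_zero]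

theorem exists_curve_unitSphere {p u : H} (hp : p ∈ unitSphere H) (hu : inner ℝ p u = 0) :
    ∃ c : ℝ → H, ContDiff ℝ ∞ c ∧ (∀ t, c t ∈ unitSphere H) ∧ c 0 = p ∧ HasDerivAt c u 0 := by
  obtain ⟨w, hw, hpw, a, -, rfl⟩ := exists_unit_smul_eq hp hu
  refine ⟨fun t => greatCircle p w (a * t), (contDiff_greatCircle p w).comp
    (contDiff_const.mul contDiff_id), fun t => greatCircle_mem hp hw hpw _, by simp, ?_⟩
  have h1 : HasDerivAt (fun t : ℝ => a * t) a 0 := by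
    simpa using (hasDerivAt_id (0 : ℝ)).const_mul a
  have h2 := (hasDerivAt_greatCircle p w (a * 0)).scomp 0 h1
  simpa [Function.comp_def] using h2

theorem mem_tangentVectors_unitSphere {p u : H} (hp : p ∈ unitSphere H) :
    u ∈ tangentVectors (unitSphere H) p ↔ inner ℝ p u = 0 := by
  constructor
  · intro hu
    have h : HasFDerivAt (fun x : H => inner ℝ x x) _ p :=
      (hasFDerivAt_id p).inner ℝ (hasFDerivAt_id p)
    have h1 := apply_eq_zero_of_mem_tangentVectors hu h.hasFDerivWithinAt (fun x hx => by
      rw [inner_self_of_mem_unitSphere hx, inner_self_of_mem_unitSphere hp])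
    simpa [real_inner_comm] using h1
  · intro hu
    obtain ⟨c, hc, hM, h0, h1⟩ := exists_curve_unitSphere hp hu
    exact mem_tangentVectors_of_hasDerivAt hc hM h0 h1

theorem mem_tangentBundle_unitSphere {x : H × H} :
    x ∈ tangentBundle (unitSphere H) ↔ x.1 ∈ unitSphere H ∧ inner ℝ x.1 x.2 = 0 :=
  and_congr_right fun h => mem_tangentVectors_unitSphere h

end Sphere

/-! ### Magnetomorphisms of the unit sphere are unitary -/

section Unitary

variable {H : Type*} [NormedAddCommGroup H] [InnerProductSpace ℂ H]

/-- A unit-speed curve on the unit sphere does not move away from its starting point faster than a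
great circle: its height above the starting point stays above `cos`. -/
theorem cos_le_inner_of_unit_speed {γ γ' : ℝ → H} (hγ : ∀ t, HasDerivAt γ (γ' t) t)
    (hS : ∀ t, γ t ∈ unitSphere H) (h1 : ∀ t, ‖γ' t‖ = 1) {t : ℝ} (h0t : 0 ≤ t)
    (htπ : t < Real.pi) :
    Real.cos t ≤ inner ℝ (γ 0) (γ t) := by
  have hperp : ∀ s, inner ℝ (γ s) (γ' s) = 0 := fun s => by
    have h := (hγ s).inner ℝ (hγ s)
    have h2 : (fun s => inner ℝ (γ s) (γ s)) = fun _ => (1 : ℝ) :=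
      funext fun s => inner_self_of_mem_unitSphere (hS s)
    rw [h2] at h
    have h3 := h.unique (hasDerivAt_const s (1 : ℝ))
    rw [real_inner_comm (γ s) (γ' s)] at h3
    linarith
  have hspeed : ∀ s, (inner ℝ (γ 0) (γ' s)) ^ 2 ≤ 1 - (inner ℝ (γ 0) (γ s)) ^ 2 := fun s => by
    set f := inner ℝ (γ 0) (γ s) with hf
    have e1 : inner ℝ (γ 0) (γ' s) = inner ℝ (γ 0 - f • γ s) (γ' s) := by
      rw [inner_sub_left, real_inner_smul_left, hperp, mul_zero, sub_zero]
    have e2 : ‖γ 0 - f • γ s‖ ^ 2 = 1 - f ^ 2 := by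
      rw [norm_sub_sq_real, real_inner_smul_right, norm_smul, mem_unitSphere.1 (hS 0),
        mem_unitSphere.1 (hS s), ← hf, mul_one, Real.norm_eq_abs, sq_abs]
      ring
    have e3 := abs_real_inner_le_norm (γ 0 - f • γ s) (γ' s)
    rw [h1, mul_one] at e3
    rw [e1, ← e2, ← sq_abs]
    exact pow_le_pow_left₀ (abs_nonneg _) e3 2
  -- The barrier `cos (ε + (1 + ε) s)` falls strictly faster than the height can.
  have key : ∀ ε : ℝ, 0 < ε → ε + (1 + ε) * t < Real.pi →
      Real.cos (ε + (1 + ε) * t) ≤ inner ℝ (γ 0) (γ t) := by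
    intro ε hε hlt
    have hf : ∀ s, HasDerivAt (fun s => -inner ℝ (γ 0) (γ s)) (-inner ℝ (γ 0) (γ' s)) s :=
      fun s => ((hasDerivAt_const s (γ 0)).inner ℝ (hγ s)).fun_neg.congr_deriv (by simp)
    have hB : ∀ s, HasDerivAt (fun s => -Real.cos (ε + (1 + ε) * s))
        ((1 + ε) * Real.sin (ε + (1 + ε) * s)) s := fun s => by
      have h := (((hasDerivAt_id s).const_mul (1 + ε)).const_add ε).cos.neg
      refine h.congr_deriv ?_
      simp [mul_comm]
    have := image_le_of_deriv_right_lt_deriv_boundary (a := 0) (b := t)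
      (fun s _ => (hf s).continuousAt.continuousWithinAt)
      (fun s _ => (hf s).hasDerivWithinAt) (B := fun s => -Real.cos (ε + (1 + ε) * s)) (by
        rw [inner_self_of_mem_unitSphere (hS 0)]
        exact neg_le_neg (Real.cos_le_one _)) hB (by
        intro s hs heq
        have hfs : inner ℝ (γ 0) (γ s) = Real.cos (ε + (1 + ε) * s) := neg_injective heq
        have hpos : 0 < Real.sin (ε + (1 + ε) * s) := by
          apply Real.sin_pos_of_pos_of_lt_pi
          · have := mul_nonneg (by linarith : 0 ≤ 1 + ε) hs.1
            linarith
          · have := mul_le_mul_of_nonneg_left hs.2.le (by linarith : 0 ≤ 1 + ε)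
            linarith
        have h2 := hspeed s
        rw [hfs, ← Real.sin_sq] at h2
        have h3 := abs_le_of_sq_le_sq h2 hpos.le
        have h4 := (abs_le.1 h3).1
        nlinarith) (right_mem_Icc.2 h0t)
    simpa using this
  have hc : Filter.Tendsto (fun ε : ℝ => Real.cos (ε + (1 + ε) * t)) (𝓝[>] 0) (𝓝 (Real.cos t)) := by
    have : Continuous (fun ε : ℝ => Real.cos (ε + (1 + ε) * t)) := by fun_prop
    have h := this.tendsto 0
    simp only [zero_add, add_zero, one_mul] at h
    exact h.mono_left nhdsWithin_le_nhds
  have hlt : ∀ᶠ ε : ℝ in 𝓝[>] 0, ε + (1 + ε) * t < Real.pi := by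
    have : Continuous (fun ε : ℝ => ε + (1 + ε) * t) := by fun_prop
    refine nhdsWithin_le_nhds (this.continuousAt.eventually_lt continuousAt_const ?_)
    simpa using htπ
  refine le_of_tendsto hc ?_
  filter_upwards [hlt, self_mem_nhdsWithin] with ε h hε using key ε hε h

theorem exists_greatCircle {p q : H} (hp : p ∈ unitSphere H) (hq : q ∈ unitSphere H) :
    ∃ w ∈ unitSphere H, inner ℝ p w = 0 ∧ ∃ t, 0 ≤ t ∧ t ≤ Real.pi ∧ greatCircle p w t = q := by
  set f := inner ℝ p q with hf
  have hperp : inner ℝ p (q - f • p) = 0 := by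
    rw [inner_sub_right, real_inner_smul_right, inner_self_of_mem_unitSphere hp, ← hf]; ring
  obtain ⟨w, hw, hpw, a, ha, hqa⟩ := exists_unit_smul_eq hp hperp
  have hq' : q = f • p + a • w := by rw [← hqa]; abel
  have h1 : f ^ 2 + a ^ 2 = 1 := by
    have := inner_self_of_mem_unitSphere hq
    rw [hq', inner_cos_sin hp hw hpw] at this
    nlinarith
  have hf1 : -1 ≤ f := by nlinarith [sq_nonneg a, sq_nonneg (f - 1)]
  have hf2 : f ≤ 1 := by nlinarith [sq_nonneg a, sq_nonneg (f + 1)]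
  refine ⟨w, hw, hpw, Real.arccos f, Real.arccos_nonneg f, Real.arccos_le_pi f, ?_⟩
  rw [greatCircle, Real.cos_arccos hf1 hf2, Real.sin_arccos, ← h1, add_sub_cancel_left,
    Real.sqrt_sq ha, ← hq']

theorem inner_le_inner_of_isometric {φ : unitSphere H → unitSphere H}
    (hφ : ContDiffOn ℝ ∞ (ambientMap φ) (unitSphere H))
    (hm : ∀ p : unitSphere H, ∀ u ∈ tangentVectors (unitSphere H) (p : H),
      ‖tangentMap φ p u‖ = ‖u‖) (p q : unitSphere H) :
    inner ℝ (p : H) (q : H) ≤ inner ℝ (φ p : H) (φ q : H) := by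
  obtain ⟨w, hw, hpw, t, h0, hπ, hq⟩ := exists_greatCircle p.2 q.2
  have hmem : ∀ s, greatCircle (p : H) w s ∈ unitSphere H := greatCircle_mem p.2 hw hpw
  have hpq : inner ℝ (p : H) (q : H) = Real.cos t := by
    have h := inner_cos_sin p.2 hw hpw 1 0 (Real.cos t) (Real.sin t)
    rw [← hq, greatCircle]
    simpa using h
  rcases hπ.lt_or_eq with hlt | rfl
  · have hd : ∀ s, HasDerivAt (ambientMap φ ∘ greatCircle (p : H) w)
        (tangentMap φ (greatCircle (p : H) w s) (-Real.sin s • (p : H) + Real.cos s • w)) s := by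
      intro s
      have hf : HasFDerivWithinAt (ambientMap φ) (tangentMap φ (greatCircle (p : H) w s))
          (unitSphere H) (greatCircle (p : H) w s) :=
        (hφ.differentiableOn (by simp) _ (hmem s)).hasFDerivWithinAt
      have := hf.comp_hasDerivWithinAt (s := univ) s
        (hasDerivAt_greatCircle (p : H) w s).hasDerivWithinAt (fun s _ => hmem s)
      exact hasDerivWithinAt_univ.1 this
    have := cos_le_inner_of_unit_speed hd (fun s => mapsTo_ambientMap φ (hmem s)) (fun s => by
      rw [hm ⟨_, hmem s⟩, norm_deriv_greatCircle p.2 hw hpw]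
      rw [← (hasDerivAt_greatCircle (p : H) w s).deriv]
      exact deriv_mem_tangentVectors (contDiff_greatCircle _ _) hmem s) h0 hlt
    rwa [Function.comp_apply, Function.comp_apply, greatCircle_zero, hq, ambientMap_apply,
      ambientMap_apply, ← hpq] at this
  · rw [hpq, Real.cos_pi]
    have := abs_real_inner_le_norm (φ p : H) (φ q : H)
    rw [mem_unitSphere.1 (φ p).2, mem_unitSphere.1 (φ q).2] at this
    linarith [(abs_le.1 this).1]

theorem IsMagnetomorphism.norm_tangentMap
    {φ : unitSphere H ≃ unitSphere H}
    (hφ : IsMagnetomorphism (unitSphere H) (dContactForm H) (unitSphere H) (dContactForm H) φ)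
    (p : unitSphere H) {u : H} (hu : u ∈ tangentVectors (unitSphere H) (p : H)) :
    ‖tangentMap φ p u‖ = ‖u‖ := by
  have h := hφ.metric p u hu u hu
  rw [real_inner_self_eq_norm_sq, real_inner_self_eq_norm_sq] at h
  exact (sq_eq_sq₀ (norm_nonneg _) (norm_nonneg _)).1 h

theorem IsMagnetomorphism.inner_eq
    {φ : unitSphere H ≃ unitSphere H}
    (hφ : IsMagnetomorphism (unitSphere H) (dContactForm H) (unitSphere H) (dContactForm H) φ)
    (p q : unitSphere H) : inner ℝ (φ p : H) (φ q : H) = inner ℝ (p : H) (q : H) := by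
  refine le_antisymm ?_
    (inner_le_inner_of_isometric hφ.smooth (fun p u hu => hφ.norm_tangentMap p hu) p q)
  have := inner_le_inner_of_isometric hφ.smooth_symm
    (fun p u hu => hφ.symm.norm_tangentMap p hu) (φ p) (φ q)
  rwa [φ.symm_apply_apply, φ.symm_apply_apply] at this

theorem inv_norm_smul_mem_unitSphere {x : H} (hx : x ≠ 0) : ‖x‖⁻¹ • x ∈ unitSphere H := by
  rw [mem_unitSphere, norm_smul, norm_inv, norm_norm, inv_mul_cancel₀ (norm_ne_zero_iff.2 hx)]

/-- A bijection of the unit sphere that preserves inner products extends to a real-linear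
isometry. -/
theorem exists_linearIsometryEquiv_of_inner_eq [Nontrivial H] (φ : unitSphere H ≃ unitSphere H)
    (hφ : ∀ p q : unitSphere H, inner ℝ (φ p : H) (φ q : H) = inner ℝ (p : H) (q : H)) :
    ∃ L : H ≃ₗᵢ[ℝ] H, ∀ p : unitSphere H, L (p : H) = φ p := by
  have hext : ∀ φ : unitSphere H ≃ unitSphere H,
      (∀ p q : unitSphere H, inner ℝ (φ p : H) (φ q : H) = inner ℝ (p : H) (q : H)) →
      ∃ L : H →ₗᵢ[ℝ] H, ∀ p : unitSphere H, L (p : H) = φ p := by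
    intro φ hφ
    -- the homogeneous extension of degree one
    have hu : ∀ x : H, ∃ p : unitSphere H, x = ‖x‖ • (p : H) := by
      intro x
      by_cases hx : x = 0
      · obtain ⟨y, hy⟩ := exists_ne (0 : H)
        exact ⟨⟨_, inv_norm_smul_mem_unitSphere hy⟩, by simp [hx]⟩
      · exact ⟨⟨_, inv_norm_smul_mem_unitSphere hx⟩, by
          rw [smul_smul, mul_inv_cancel₀ (norm_ne_zero_iff.2 hx), one_smul]⟩
    choose n hn using hu
    obtain ⟨G, hG⟩ : ∃ G : H → H, ∀ x, G x = ‖x‖ • (φ (n x) : H) := ⟨_, fun _ => rfl⟩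
    have hinner : ∀ x y : H, inner ℝ (G x) (G y) = inner ℝ x y := by
      intro x y
      conv_rhs => rw [hn x, hn y]
      simp only [hG, real_inner_smul_left, real_inner_smul_right, hφ]
    -- additivity: the squared norm of the defect is a combination of inner products of values
    have hlin : ∀ (a b : ℝ) (x y : H), G (a • x + b • y) = a • G x + b • G y := by
      intro a b x y
      obtain ⟨z, hz⟩ : ∃ z, z = a • x + b • y := ⟨_, rfl⟩
      have h1 : inner ℝ (G z - (a • G x + b • G y)) (G z - (a • G x + b • G y)) =
          inner ℝ (z - (a • x + b • y)) (z - (a • x + b • y)) := by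
        simp only [inner_sub_left, inner_sub_right, inner_add_left, inner_add_right,
          real_inner_smul_left, real_inner_smul_right, hinner]
      rw [← hz, ← sub_eq_zero, ← inner_self_eq_zero (𝕜 := ℝ), h1, ← hz, sub_self, inner_zero_left]
    let L₀ : H →ₗ[ℝ] H :=
      { toFun := G
        map_add' := fun x y => by simpa using hlin 1 1 x y
        map_smul' := fun a x => by simpa using hlin a 0 x 0 }
    refine ⟨L₀.isometryOfInner hinner, fun p => ?_⟩
    change G p = φ p
    have h1 : n (p : H) = p := Subtype.ext <| by
      have := hn (p : H)
      rw [mem_unitSphere.1 p.2, one_smul] at this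
      exact this.symm
    rw [hG, h1, mem_unitSphere.1 p.2, one_smul]
  obtain ⟨L, hL⟩ := hext φ hφ
  have hsurj : Function.Surjective L := by
    intro y
    by_cases hy : y = 0
    · exact ⟨0, by simp [hy]⟩
    · refine ⟨‖y‖ • (φ.symm ⟨_, inv_norm_smul_mem_unitSphere hy⟩ : H), ?_⟩
      rw [map_smul, hL, φ.apply_symm_apply, smul_smul, mul_inv_cancel₀ (norm_ne_zero_iff.2 hy),
        one_smul]
  exact ⟨LinearIsometryEquiv.ofSurjective L hsurj, hL⟩

theorem eqOn_ambientMap {φ : unitSphere H → unitSphere H} {L : H → H}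
    (hL : ∀ p : unitSphere H, L (p : H) = φ p) : EqOn (ambientMap φ) L (unitSphere H) :=
  fun p hp => by rw [hL ⟨p, hp⟩, ambientMap_apply φ ⟨p, hp⟩]

theorem tangentMap_of_eq {φ : unitSphere H → unitSphere H} (L : H →L[ℝ] H)
    (hL : ∀ p : unitSphere H, L (p : H) = φ p) (p : unitSphere H) {u : H}
    (hu : u ∈ tangentVectors (unitSphere H) (p : H)) : tangentMap φ p u = L u :=
  fderivWithin_apply_of_eqOn p.2 hu L (eqOn_ambientMap hL)

/-- A real-linear isometry whose restriction to the sphere preserves the magnetic field commutes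
with `i`. Complex dimension at least two is needed: the magnetic field of a circle vanishes. -/
theorem IsMagnetomorphism.commute_I (hdim : ∀ u : H, ∃ w ∈ unitSphere H, inner ℂ u w = 0)
    {φ : unitSphere H ≃ unitSphere H}
    (hφ : IsMagnetomorphism (unitSphere H) (dContactForm H) (unitSphere H) (dContactForm H) φ)
    (L : H ≃ₗᵢ[ℝ] H) (hL : ∀ p : unitSphere H, L (p : H) = φ p) (u : H) :
    L (Complex.I • u) = Complex.I • L u := by
  by_cases hu : u = 0
  · simp [hu]
  have key : ∀ p ∈ unitSphere H, inner ℝ p u = 0 → ∀ v, inner ℝ p v = 0 →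
      inner ℝ (Complex.I • L u - L (Complex.I • u)) (L v) = 0 := by
    intro p hp hpu v hpv
    have hu' := (mem_tangentVectors_unitSphere hp).2 hpu
    have hv' := (mem_tangentVectors_unitSphere hp).2 hpv
    have h := hφ.field ⟨p, hp⟩ u hu' v hv'
    rw [tangentMap_of_eq (L.toContinuousLinearEquiv : H →L[ℝ] H) hL ⟨p, hp⟩ hu',
      tangentMap_of_eq (L.toContinuousLinearEquiv : H →L[ℝ] H) hL ⟨p, hp⟩ hv',
      dContactForm_apply, dContactForm_apply, ← L.inner_map_map (Complex.I • u) v] at h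
    rw [inner_sub_left, sub_eq_zero]
    exact h
  -- two orthogonal base points, each orthogonal to `u`
  obtain ⟨w, hw, huw⟩ := hdim u
  have hwu : inner ℝ w u = 0 := by
    rw [real_inner_comm, real_inner_eq_re_inner ℂ, huw]; simp
  have hp : Complex.I • ‖u‖⁻¹ • u ∈ unitSphere H := by
    rw [mem_unitSphere_iff_inner, inner_I_smul_I_smul]
    exact inner_self_of_mem_unitSphere (inv_norm_smul_mem_unitSphere hu)
  set p := Complex.I • ‖u‖⁻¹ • u with hpdef
  have hpu : inner ℝ p u = 0 := by
    rw [hpdef, inner_I_smul_left_eq_neg, real_inner_smul_left, inner_self_I_smul]; simp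
  have hwp : inner ℝ w p = 0 := by
    rw [real_inner_comm, hpdef, smul_comm, real_inner_smul_left, real_inner_eq_re_inner ℂ,
      inner_smul_left, huw]
    simp
  have h1 := key w hw hwu p hwp
  have h2 : ∀ v, inner ℝ (Complex.I • L u - L (Complex.I • u)) (L v) = 0 := by
    intro v
    have h3 := key p hp hpu (v - inner ℝ p v • p) (by
      rw [inner_sub_right, real_inner_smul_right, inner_self_of_mem_unitSphere hp]; ring)
    rwa [L.map_sub, L.map_smul, inner_sub_right, real_inner_smul_right, h1, mul_zero,
      sub_zero] at h3
  have h4 := h2 (L.symm (Complex.I • L u - L (Complex.I • u)))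
  rw [L.apply_symm_apply, inner_self_eq_zero, sub_eq_zero] at h4
  exact h4.symm

section Complete

variable [CompleteSpace H]

theorem unitary_inner_map (U : UnitaryGroup H) (x y : H) :
    inner ℂ ((U : H →L[ℂ] H) x) ((U : H →L[ℂ] H) y) = inner ℂ x y :=
  (Unitary.linearIsometryEquiv U).inner_map_map x y

theorem unitary_real_inner_map (U : UnitaryGroup H) (x y : H) :
    inner ℝ ((U : H →L[ℂ] H) x) ((U : H →L[ℂ] H) y) = inner ℝ x y := by
  rw [real_inner_eq_re_inner ℂ, real_inner_eq_re_inner ℂ, unitary_inner_map]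

/-- The restriction of unitary operators to the unit sphere. -/
noncomputable def sphereAction (H : Type*) [NormedAddCommGroup H] [InnerProductSpace ℂ H]
    [CompleteSpace H] :
    UnitaryGroup H →* Equiv.Perm (unitSphere H) :=
  MonoidHom.toHomPerm
    { toFun := fun U p => ⟨(U : H →L[ℂ] H) p, by
        rw [mem_unitSphere_iff_inner, unitary_real_inner_map, inner_self_of_mem_unitSphere p.2]⟩
      map_one' := rfl
      map_mul' := fun _ _ => rfl }

theorem sphereAction_apply (U : UnitaryGroup H) (p : unitSphere H) :
    (sphereAction H U p : H) = (U : H →L[ℂ] H) p := rfl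

theorem tangentMap_sphereAction (U : UnitaryGroup H) (p : unitSphere H) {u : H}
    (hu : u ∈ tangentVectors (unitSphere H) (p : H)) :
    tangentMap (sphereAction H U) p u = (U : H →L[ℂ] H) u :=
  tangentMap_of_eq ((U : H →L[ℂ] H).restrictScalars ℝ) (fun _ => rfl) p hu

theorem contDiffOn_sphereAction (U : UnitaryGroup H) :
    ContDiffOn ℝ ∞ (ambientMap (sphereAction H U)) (unitSphere H) :=
  ((U : H →L[ℂ] H).restrictScalars ℝ).contDiff.contDiffOn.congr (eqOn_ambientMap fun _ => rfl)

theorem isMagnetomorphism_sphereAction (U : UnitaryGroup H) :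
    IsMagnetomorphism (unitSphere H) (dContactForm H) (unitSphere H) (dContactForm H)
      (sphereAction H U) where
  smooth := contDiffOn_sphereAction U
  smooth_symm := contDiffOn_sphereAction U⁻¹
  metric p u hu v hv := by
    rw [tangentMap_sphereAction U p hu, tangentMap_sphereAction U p hv, unitary_real_inner_map]
  field p u hu v hv := by
    rw [tangentMap_sphereAction U p hu, tangentMap_sphereAction U p hv, dContactForm_apply,
      dContactForm_apply, ← map_smul, unitary_real_inner_map]

theorem sphereAction_injective : Function.Injective (sphereAction H) := by
  intro U U' h
  refine Subtype.ext (ContinuousLinearMap.ext fun x => ?_)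
  by_cases hx : x = 0
  · simp [hx]
  · have h1 := congrArg Subtype.val
      (Equiv.congr_fun h ⟨_, inv_norm_smul_mem_unitSphere hx⟩)
    simp only [sphereAction_apply] at h1
    have h2 := congrArg (fun y => ‖x‖ • y) h1
    simpa [← ContinuousLinearMap.map_smul_of_tower, smul_smul, norm_ne_zero_iff.2 hx] using h2

theorem exists_sphereAction_eq (hdim : ∀ u : H, ∃ w ∈ unitSphere H, inner ℂ u w = 0)
    {φ : unitSphere H ≃ unitSphere H}
    (hφ : IsMagnetomorphism (unitSphere H) (dContactForm H) (unitSphere H) (dContactForm H) φ) :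
    ∃ U, sphereAction H U = φ := by
  obtain ⟨w, hw, -⟩ := hdim 0
  have : Nontrivial H := ⟨w, 0, fun h => by simp [h, mem_unitSphere] at hw⟩
  obtain ⟨L, hL⟩ := exists_linearIsometryEquiv_of_inner_eq φ hφ.inner_eq
  have hI := hφ.commute_I hdim L hL
  let L' : H ≃ₗᵢ[ℂ] H :=
    { toFun := L
      invFun := L.symm
      left_inv := L.left_inv
      right_inv := L.right_inv
      map_add' := L.map_add
      map_smul' := fun z x => by
        simp only [RingHom.id_apply]
        rw [complex_smul_eq, map_add, map_smul, map_smul, hI, complex_smul_eq z]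
      norm_map' := L.norm_map }
  refine ⟨Unitary.linearIsometryEquiv.symm L', Equiv.ext fun p => Subtype.ext ?_⟩
  rw [sphereAction_apply, ← hL]
  rfl

/-- The unitary group is the group of magnetomorphisms of the unit sphere. -/
noncomputable def unitaryEquivMagGroup (hdim : ∀ u : H, ∃ w ∈ unitSphere H, inner ℂ u w = 0) :
    UnitaryGroup H ≃* magGroup (unitSphere H) (dContactForm H) :=
  MulEquiv.ofBijective
    ((sphereAction H).codRestrict (magGroup (unitSphere H) (dContactForm H))
      isMagnetomorphism_sphereAction)
    ⟨fun _ _ h => sphereAction_injective (congrArg Subtype.val h), fun φ =>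
      (exists_sphereAction_eq hdim φ.2).imp fun _ h => Subtype.ext h⟩

end Complete

theorem L2Circle.exists_orthonormal_pair :
    ∃ a b : L2Circle, ‖a‖ = 1 ∧ ‖b‖ = 1 ∧ inner ℂ a b = 0 := by
  have h : ∀ μ : MeasureTheory.Measure UnitAddCircle, μ = AddCircle.haarAddCircle →
      ∃ a b : MeasureTheory.Lp ℂ 2 μ, ‖a‖ = 1 ∧ ‖b‖ = 1 ∧ inner ℂ a b = 0 := by
    rintro μ rfl
    have ho := orthonormal_fourier (T := 1)
    exact ⟨fourierLp 2 0, fourierLp 2 1, ho.1 0, ho.1 1, ho.2 zero_ne_one⟩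
  exact h _ (by rw [AddCircle.volume_eq_smul_haarAddCircle]; simp)

/-- `L²` of the circle contains two orthogonal unit vectors, and so a unit vector orthogonal to
any given one. -/
theorem L2Circle.exists_orthogonal (u : L2Circle) :
    ∃ w ∈ unitSphere L2Circle, inner ℂ u w = 0 := by
  obtain ⟨a, b, ha, hb, hab⟩ := L2Circle.exists_orthonormal_pair
  have key : ∃ x : L2Circle, x ≠ 0 ∧ inner ℂ u x = 0 := by
    by_cases h : inner ℂ u a = 0
    · exact ⟨a, fun h0 => by simp [h0] at ha, h⟩
    · refine ⟨inner ℂ u b • a - inner ℂ u a • b, fun h0 => h ?_, ?_⟩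
      · have h1 := congrArg (fun y => inner ℂ b y) h0
        simp only [inner_sub_right, inner_smul_right, inner_eq_zero_symm.1 hab,
          inner_zero_right] at h1
        rw [inner_self_eq_norm_sq_to_K, hb] at h1
        simpa using h1
      · rw [inner_sub_right, inner_smul_right, inner_smul_right]; ring
  obtain ⟨x, hx, hux⟩ := key
  refine ⟨_, inv_norm_smul_mem_unitSphere hx, ?_⟩
  rw [inner_smul_right_eq_smul, hux, smul_zero]

end Unitary

/-! ### The twisted symplectic form on the tangent bundle of the unit sphere -/

section Twisted

variable {H : Type*} [NormedAddCommGroup H] [InnerProductSpace ℂ H]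

/-- The Liouville form, as a continuous linear map into the dual space. -/
noncomputable def liouvilleCLM (H : Type*) [NormedAddCommGroup H] [InnerProductSpace ℂ H] :
    (H × H) →L[ℝ] (H × H) →L[ℝ] ℝ :=
  ((ContinuousLinearMap.compL ℝ (H × H) H ℝ).flip (ContinuousLinearMap.fst ℝ H H)).comp
    ((innerSL ℝ).comp (ContinuousLinearMap.snd ℝ H H))

theorem liouvilleForm_eq : (liouvilleForm : H × H → _) = fun x => liouvilleCLM H x := rfl

theorem twistedForm_apply (x ξ η : H × H) :
    twistedForm (dContactForm H) x ![ξ, η] =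
      inner ℝ ξ.2 η.1 - inner ℝ η.2 ξ.1 - inner ℝ (Complex.I • ξ.1) η.1 := by
  rw [twistedForm, ContinuousAlternatingMap.sub_apply, liouvilleForm_eq, extDeriv_linear_apply,
    ContinuousAlternatingMap.compContinuousLinearMap_apply]
  have : (⇑(ContinuousLinearMap.fst ℝ H H) ∘ ![ξ, η]) = ![ξ.1, η.1] := by
    ext i; fin_cases i <;> rfl
  rw [this, dContactForm_apply]
  rfl

theorem twistedForm_const : ∃ Ω, twistedForm (dContactForm H) = fun _ => Ω := by
  obtain ⟨Ω₁, h₁⟩ := exists_extDeriv_linear_eq_const (liouvilleCLM H)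
  obtain ⟨Ω₂, h₂⟩ := dContactForm_const (H := H)
  refine ⟨Ω₁ - Ω₂.compContinuousLinearMap (ContinuousLinearMap.fst ℝ H H), funext fun x => ?_⟩
  rw [twistedForm, liouvilleForm_eq, h₁, h₂]

theorem mem_tangentVectors_tangentBundle {x : H × H} (hx : x ∈ tangentBundle (unitSphere H))
    {ξ : H × H} : ξ ∈ tangentVectors (tangentBundle (unitSphere H)) x ↔
      inner ℝ x.1 ξ.1 = 0 ∧ inner ℝ ξ.1 x.2 + inner ℝ x.1 ξ.2 = 0 := by
  obtain ⟨h1, h2⟩ := mem_tangentBundle_unitSphere.1 hx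
  constructor
  · intro hξ
    have hfst : HasFDerivAt (fun y : H × H => y.1) (ContinuousLinearMap.fst ℝ H H) x :=
      (ContinuousLinearMap.fst ℝ H H).hasFDerivAt
    have hsnd : HasFDerivAt (fun y : H × H => y.2) (ContinuousLinearMap.snd ℝ H H) x :=
      (ContinuousLinearMap.snd ℝ H H).hasFDerivAt
    have e1 := apply_eq_zero_of_mem_tangentVectors hξ (hfst.inner ℝ hfst).hasFDerivWithinAt
      (fun y hy => by
        rw [inner_self_of_mem_unitSphere (mem_tangentBundle_unitSphere.1 hy).1,
          inner_self_of_mem_unitSphere h1])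
    have e2 := apply_eq_zero_of_mem_tangentVectors hξ (hfst.inner ℝ hsnd).hasFDerivWithinAt
      (fun y hy => by rw [(mem_tangentBundle_unitSphere.1 hy).2, h2])
    simp only [ContinuousLinearMap.comp_apply, fderivInnerCLM_apply,
      ContinuousLinearMap.prod_apply, ContinuousLinearMap.coe_fst',
      ContinuousLinearMap.coe_snd'] at e1 e2
    rw [real_inner_comm x.1 ξ.1] at e1
    constructor <;> linarith
  · rintro ⟨e1, e2⟩
    obtain ⟨c, hc, hM, h0, hd⟩ := exists_curve_unitSphere h1 e1
    -- the second component is the projection of `x.2 + t ξ.2` to the tangent space at `c t`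
    have hg : ContDiff ℝ ∞ (fun t : ℝ => x.2 + t • ξ.2) := by fun_prop
    have hgd : HasDerivAt (fun t : ℝ => x.2 + t • ξ.2) ξ.2 0 := by
      simpa using ((hasDerivAt_id (0 : ℝ)).smul_const ξ.2).const_add x.2
    refine mem_tangentVectors_of_hasDerivAt
      (c := fun t => (c t, x.2 + t • ξ.2 - (inner ℝ (c t) (x.2 + t • ξ.2) : ℝ) • c t))
      (hc.prodMk (hg.sub ((hc.inner ℝ hg).smul hc))) (fun t => ?_) ?_ ?_
    · refine mem_tangentBundle_unitSphere.2 ⟨hM t, ?_⟩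
      simp only
      rw [inner_sub_right, real_inner_smul_right, inner_self_of_mem_unitSphere (hM t)]
      ring
    · simp [h0, h2]
    · have h := hd.prodMk (hgd.fun_sub ((hd.inner ℝ hgd).fun_smul hd))
      refine h.congr_deriv ?_
      simp [h0, h2, add_comm (inner ℝ x.1 ξ.2), e2]

theorem isSymplecticOn_twistedForm :
    IsSymplecticOn (tangentBundle (unitSphere H)) (twistedForm (dContactForm H)) := by
  obtain ⟨Ω, hΩ⟩ := twistedForm_const (H := H)
  refine ⟨by rw [hΩ]; exact contDiff_const, fun x _ u _ v _ w _ => ?_, ?_⟩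
  · rw [hΩ, extDeriv, fderiv_fun_const]
    simp [ContinuousAlternatingMap.alternatizeUncurryFin_apply]
  · intro x hx ξ hξ h
    have hξ' := (mem_tangentVectors_tangentBundle hx).1 hξ
    have hx' := mem_tangentBundle_unitSphere.1 hx
    -- vertical vectors detect the horizontal component
    have h1 : ξ.1 = 0 := by
      have := h (0, ξ.1) ((mem_tangentVectors_tangentBundle hx).2 (by simp [hξ'.1]))
      rw [twistedForm_apply] at this
      simpa using this
    have h2 : ξ.2 = 0 := by
      have h3 : inner ℝ x.1 ξ.2 = 0 := by simpa [h1] using hξ'.2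
      have := h (ξ.2, -(inner ℝ ξ.2 x.2 : ℝ) • x.1) ((mem_tangentVectors_tangentBundle hx).2 (by
        refine ⟨h3, ?_⟩
        rw [real_inner_smul_right, inner_self_of_mem_unitSphere hx'.1]
        ring))
      rw [twistedForm_apply] at this
      simpa [h1] using this
    exact Prod.ext h1 h2

/-- The canonical momentum `(f, F) ↦ Re ⟨F, ·⟩ - α_f`, as a continuous linear map. -/
noncomputable def magneticMomentum (H : Type*) [NormedAddCommGroup H] [InnerProductSpace ℂ H] :
    (H × H) →L[ℝ] H →L[ℝ] ℝ :=
  ContinuousLinearMap.coprod (-contactCLM H) (innerSL ℝ)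

theorem magneticMomentum_apply (x : H × H) (y : H) :
    magneticMomentum H x y = inner ℝ x.2 y - 1 / 2 * inner ℝ (Complex.I • x.1) y := by
  change -(1 / 2 * inner ℝ (Complex.I • x.1) y) + inner ℝ x.2 y = _
  ring

end Twisted

/-! ### The moment map of the unitary group -/

section Moment

variable {H : Type*} [NormedAddCommGroup H] [InnerProductSpace ℂ H] [CompleteSpace H]

/-- The evaluation `f ↦ (A ↦ A f)` on skew-adjoint operators. -/
noncomputable def evalSkew (H : Type*) [NormedAddCommGroup H] [InnerProductSpace ℂ H]
    [CompleteSpace H] : H →L[ℝ] UnitaryLieAlgebra H →L[ℝ] H :=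
  LinearMap.mkContinuous₂
    (LinearMap.mk₂ ℝ (fun (f : H) (A : UnitaryLieAlgebra H) => (A : H →L[ℂ] H) f)
      (fun f g A => map_add _ f g)
      (fun a f A => ContinuousLinearMap.map_smul_of_tower (A : H →L[ℂ] H) a f)
      (fun _ _ _ => rfl) (fun _ _ _ => rfl)) 1 (fun f A => by
      rw [one_mul, mul_comm]
      exact (A : H →L[ℂ] H).le_opNorm f)

/-- The moment map `μ (f, F) A = Re ⟨A f, F⟩ - α_f (A f)`. -/
noncomputable def momentMap (x : H × H) : UnitaryLieAlgebra H →L[ℝ] ℝ :=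
  (magneticMomentum H x).comp (evalSkew H x.1)

theorem momentMap_apply (x : H × H) (A : UnitaryLieAlgebra H) :
    momentMap x A = inner ℝ x.2 ((A : H →L[ℂ] H) x.1) -
      1 / 2 * inner ℝ (Complex.I • x.1) ((A : H →L[ℂ] H) x.1) :=
  magneticMomentum_apply x _

theorem contDiff_evalSkew : ContDiff ℝ ∞ (evalSkew H) := by
  apply ContinuousLinearMap.contDiff

theorem contDiff_momentMap : ContDiff ℝ ∞ (momentMap : H × H → _) :=
  (magneticMomentum H).contDiff.clm_comp (contDiff_evalSkew.comp contDiff_fst)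

theorem inner_skew (A : UnitaryLieAlgebra H) (x y : H) :
    inner ℝ ((A : H →L[ℂ] H) x) y = -inner ℝ x ((A : H →L[ℂ] H) y) := by
  have hA : star (A : H →L[ℂ] H) = -(A : H →L[ℂ] H) := A.2
  have h := ContinuousLinearMap.adjoint_inner_right (A : H →L[ℂ] H) x y
  rw [← ContinuousLinearMap.star_eq_adjoint, hA, neg_apply,
    inner_neg_right] at h
  rw [real_inner_eq_re_inner ℂ, real_inner_eq_re_inner ℂ, ← h, map_neg]

theorem fderiv_momentMap_apply (x w : H × H) (A : UnitaryLieAlgebra H) :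
    fderiv ℝ momentMap x w A = inner ℝ w.2 ((A : H →L[ℂ] H) x.1) +
      inner ℝ x.2 ((A : H →L[ℂ] H) w.1) - inner ℝ (Complex.I • w.1) ((A : H →L[ℂ] H) x.1) := by
  have h3 : HasFDerivAt (momentMap : H × H → _) _ x :=
    (magneticMomentum H).hasFDerivAt.clm_comp
      (ContinuousLinearMap.hasFDerivAt (F := UnitaryLieAlgebra H →L[ℝ] H)
        ((evalSkew H).comp (ContinuousLinearMap.fst ℝ H H)))
  rw [h3.fderiv]
  change magneticMomentum H x ((A : H →L[ℂ] H) w.1) +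
    magneticMomentum H w ((A : H →L[ℂ] H) x.1) = _
  rw [magneticMomentum_apply, magneticMomentum_apply]
  have h4 : inner ℝ (Complex.I • x.1) ((A : H →L[ℂ] H) w.1) =
      inner ℝ (Complex.I • w.1) ((A : H →L[ℂ] H) x.1) := by
    have h5 := inner_skew A (Complex.I • x.1) w.1
    rw [map_smul, inner_I_smul_left_eq_neg, real_inner_comm] at h5
    linarith
  rw [h4]
  ring

theorem eqOn_tangentLift (U : UnitaryGroup H) :
    EqOn (tangentLift (sphereAction H U))
      (((U : H →L[ℂ] H).restrictScalars ℝ).prodMap ((U : H →L[ℂ] H).restrictScalars ℝ))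
      (tangentBundle (unitSphere H)) := by
  intro x hx
  refine Prod.ext ?_ ?_
  · exact ambientMap_apply (sphereAction H U) ⟨x.1, hx.1⟩
  · exact tangentMap_sphereAction U ⟨x.1, hx.1⟩ hx.2

theorem tangentLift_sphereAction (U : UnitaryGroup H) {x : H × H}
    (hx : x ∈ tangentBundle (unitSphere H)) :
    tangentLift (sphereAction H U) x = ((U : H →L[ℂ] H) x.1, (U : H →L[ℂ] H) x.2) :=
  eqOn_tangentLift U hx

theorem mapsTo_tangentLift (U : UnitaryGroup H) :
    MapsTo (tangentLift (sphereAction H U)) (tangentBundle (unitSphere H))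
      (tangentBundle (unitSphere H)) := by
  intro x hx
  obtain ⟨h1, h2⟩ := mem_tangentBundle_unitSphere.1 hx
  rw [tangentLift_sphereAction U hx, mem_tangentBundle_unitSphere, mem_unitSphere_iff_inner]
  simp only [unitary_real_inner_map]
  exact ⟨inner_self_of_mem_unitSphere h1, h2⟩

theorem hasDerivAt_unitaryExp_apply (A : UnitaryLieAlgebra H) (x : H) :
    HasDerivAt (fun t : ℝ => (unitaryExp (t • A) : H →L[ℂ] H) x) ((A : H →L[ℂ] H) x) 0 := by
  have h : HasDerivAt (fun t : ℝ => NormedSpace.exp (t • (A : H →L[ℂ] H)))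
      (NormedSpace.exp ((0 : ℝ) • (A : H →L[ℂ] H)) * (A : H →L[ℂ] H)) 0 :=
    hasDerivAt_exp_smul_const (A : H →L[ℂ] H) (0 : ℝ)
  rw [zero_smul, NormedSpace.exp_zero, one_mul] at h
  exact ((ContinuousLinearMap.apply ℂ H x).restrictScalars ℝ).hasFDerivAt.comp_hasDerivAt
    (0 : ℝ) h

theorem unitary_real_inner_left (U : UnitaryGroup H) (y z : H) :
    inner ℝ ((U : H →L[ℂ] H) y) z = inner ℝ y (star (U : H →L[ℂ] H) z) := by
  have h := ContinuousLinearMap.adjoint_inner_right (U : H →L[ℂ] H) y z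
  rw [← ContinuousLinearMap.star_eq_adjoint] at h
  rw [real_inner_eq_re_inner ℂ, real_inner_eq_re_inner ℂ, h]

theorem unitaryAd_inv_apply (U : UnitaryGroup H) (A : UnitaryLieAlgebra H) (y : H) :
    (unitaryAd U⁻¹ A : H →L[ℂ] H) y =
      star (U : H →L[ℂ] H) ((A : H →L[ℂ] H) ((U : H →L[ℂ] H) y)) := by
  have h : (unitaryAd U⁻¹ A : H →L[ℂ] H) =
      star (U : H →L[ℂ] H) * (A : H →L[ℂ] H) * star (star (U : H →L[ℂ] H)) := rfl
  rw [h, star_star]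
  rfl

theorem momentMap_unitary (U : UnitaryGroup H) (x : H × H) (A : UnitaryLieAlgebra H) :
    momentMap ((U : H →L[ℂ] H) x.1, (U : H →L[ℂ] H) x.2) A = momentMap x (unitaryAd U⁻¹ A) := by
  have e1 := unitary_real_inner_left U x.2 ((A : H →L[ℂ] H) ((U : H →L[ℂ] H) x.1))
  have e2 := unitary_real_inner_left U (Complex.I • x.1)
    ((A : H →L[ℂ] H) ((U : H →L[ℂ] H) x.1))
  have e3 : (U : H →L[ℂ] H) (Complex.I • x.1) = Complex.I • (U : H →L[ℂ] H) x.1 :=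
    ContinuousLinearMap.map_smul _ _ _
  rw [e3] at e2
  rw [momentMap_apply, momentMap_apply, unitaryAd_inv_apply]
  exact congrArg₂ (fun a b : ℝ => a - 1 / 2 * b) e1 e2

theorem fderiv_momentMap_eq_neg_twistedForm (x w : H × H) (A : UnitaryLieAlgebra H) :
    fderiv ℝ momentMap x w A =
      -twistedForm (dContactForm H) x ![((A : H →L[ℂ] H) x.1, (A : H →L[ℂ] H) x.2), w] := by
  have e1 := inner_skew A x.2 w.1
  have e2 := inner_I_smul_left_eq_neg w.1 ((A : H →L[ℂ] H) x.1)
  rw [fderiv_momentMap_apply, twistedForm_apply]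
  simp only
  rw [e1, e2, real_inner_comm (Complex.I • (A : H →L[ℂ] H) x.1) w.1]
  ring

theorem fderivWithin_momentMap_apply {M : Set (H × H)} {x w : H × H}
    (hw : w ∈ tangentVectors M x) :
    fderivWithin ℝ momentMap M x w = fderiv ℝ momentMap x w :=
  fderivWithin_apply_of_mem_tangentVectors (E' := UnitaryLieAlgebra H →L[ℝ] ℝ) hw
    (contDiff_momentMap.differentiable (by simp) x).hasFDerivAt.hasFDerivWithinAt

theorem isHamiltonianAction_sphereAction :
    IsHamiltonianAction (tangentBundle (unitSphere H)) (twistedForm (dContactForm H))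
      (fun U => tangentLift (sphereAction H U)) momentMap where
  mapsTo := mapsTo_tangentLift
  one_act x hx := by rw [tangentLift_sphereAction 1 hx]; rfl
  mul_act U U' x hx := by
    rw [tangentLift_sphereAction U (mapsTo_tangentLift U' hx), tangentLift_sphereAction U' hx,
      tangentLift_sphereAction (U * U') hx]
    rfl
  smooth_act U := (ContinuousLinearMap.contDiff _).contDiffOn.congr (eqOn_tangentLift U)
  symplectic U x hx u hu v hv := by
    rw [fderivWithin_apply_of_eqOn hx hu _ (eqOn_tangentLift U),
      fderivWithin_apply_of_eqOn hx hv _ (eqOn_tangentLift U), twistedForm_apply,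
      twistedForm_apply]
    simp only [ContinuousLinearMap.coe_prodMap',
      ContinuousLinearMap.coe_restrictScalars', Prod.map_fst, Prod.map_snd, ← map_smul,
      unitary_real_inner_map]
  smooth_moment := contDiff_momentMap.contDiffOn
  hamiltonian A x hx := by
    obtain ⟨h1, h2⟩ := mem_tangentBundle_unitSphere.1 hx
    refine ⟨((A : H →L[ℂ] H) x.1, (A : H →L[ℂ] H) x.2),
      (mem_tangentVectors_tangentBundle hx).2 ⟨?_, ?_⟩, ?_, fun w hw => ?_⟩
    · have h := inner_skew A x.1 x.1
      rw [real_inner_comm] at h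
      linarith
    · rw [inner_skew]; ring
    · simp only [tangentLift_sphereAction _ hx]
      exact (hasDerivAt_unitaryExp_apply A x.1).prodMk (hasDerivAt_unitaryExp_apply A x.2)
    · rw [fderivWithin_momentMap_apply hw, fderiv_momentMap_eq_neg_twistedForm]
  equivariant U x hx A := by
    rw [tangentLift_sphereAction U hx, momentMap_unitary]

end Moment

/-! ### Embedded submanifolds of a Hilbert space -/

section Embedded

variable {E : Type*} [NormedAddCommGroup E] [InnerProductSpace ℝ E]

theorem tangentVectors_inter {N U : Set E} (hU : IsOpen U) {p u : E} (hp : p ∈ U)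
    (hu : u ∈ tangentVectors N p) : u ∈ tangentVectors (N ∩ U) p := by
  obtain ⟨ε, hε, c, hc, hM, h0, h1⟩ := hu
  have hn : Ioo (-ε) ε ∈ 𝓝 (0 : ℝ) := isOpen_Ioo.mem_nhds ⟨by linarith, hε⟩
  have hcont : ContinuousAt c 0 := (hc.contDiffAt hn).continuousAt
  have hev : ∀ᶠ t in 𝓝 (0 : ℝ), c t ∈ U :=
    hcont.eventually_mem (hU.mem_nhds (by rwa [h0]))
  obtain ⟨δ, hδ, hball⟩ := Metric.eventually_nhds_iff_ball.1 hev
  rw [Real.ball_eq_Ioo, zero_sub, zero_add] at hball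
  refine ⟨min ε δ, lt_min hε hδ, c, ?_, ?_, h0, h1⟩
  · exact hc.mono (Ioo_subset_Ioo (neg_le_neg (min_le_left _ _)) (min_le_left _ _))
  · intro t ht
    exact ⟨hM t (Ioo_subset_Ioo (neg_le_neg (min_le_left _ _)) (min_le_left _ _) ht),
      hball t (Ioo_subset_Ioo (neg_le_neg (min_le_right _ _)) (min_le_right _ _) ht)⟩

theorem mem_iff_apply_mem_of_chart {E : Type*} [TopologicalSpace E] {N : Set E}
    {χ : OpenPartialHomeomorph E E} {W : Set E}
    (hχ : χ '' (χ.source ∩ N) = χ.target ∩ W) {q : E} (hq : q ∈ χ.source) :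
    q ∈ N ↔ χ q ∈ W := by
  constructor
  · intro h
    have : χ q ∈ χ '' (χ.source ∩ N) := ⟨q, ⟨hq, h⟩, rfl⟩
    rw [hχ] at this
    exact this.2
  · intro h
    have : χ q ∈ χ '' (χ.source ∩ N) := by
      rw [hχ]; exact ⟨χ.map_source hq, h⟩
    obtain ⟨q', ⟨hq', hN⟩, he⟩ := this
    rwa [← χ.injOn hq' hq he]

/-- In a chart that straightens `N` to `W`, the tangent vectors of `N` are the vectors that the
derivative of the chart maps into `W`. -/
theorem mem_tangentVectors_iff_of_chart [CompleteSpace E] {N : Set E}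
    {χ : OpenPartialHomeomorph E E} {W : Submodule ℝ E}
    (hW : IsClosed (W : Set E)) (h1 : ContDiffOn ℝ ∞ χ χ.source)
    (h2 : ContDiffOn ℝ ∞ χ.symm χ.target) (hχ : χ '' (χ.source ∩ N) = χ.target ∩ (W : Set E))
    {q : E} (hq : q ∈ χ.source) (hqN : q ∈ N) {u : E} :
    u ∈ tangentVectors N q ↔ fderiv ℝ χ q u ∈ W := by
  have : CompleteSpace W := hW.completeSpace_coe
  have hd : HasFDerivAt χ (fderiv ℝ χ q) q :=
    ((h1.contDiffAt (χ.open_source.mem_nhds hq)).differentiableAt (by simp)).hasFDerivAt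
  constructor
  · intro hu
    have hu' := tangentVectors_inter χ.open_source hq hu
    have h3 := apply_eq_zero_of_mem_tangentVectors hu'
      (((Wᗮ.starProjection).hasFDerivAt.comp q hd).hasFDerivWithinAt) (fun x hx => by
        have e1 := (mem_iff_apply_mem_of_chart hχ hx.2).1 hx.1
        have e2 := (mem_iff_apply_mem_of_chart hχ hq).1 hqN
        simp only [Function.comp_apply]
        rw [Submodule.starProjection_orthogonal_apply_eq_zero e1,
          Submodule.starProjection_orthogonal_apply_eq_zero e2])
    rwa [ContinuousLinearMap.comp_apply, Submodule.starProjection_orthogonal_val, sub_eq_zero,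
      eq_comm, Submodule.starProjection_eq_self_iff] at h3
  · intro hu
    set w := fderiv ℝ χ q u with hw
    have hqt : χ q ∈ χ.target := χ.map_source hq
    have hlin : Continuous fun t : ℝ => χ q + t • w := by fun_prop
    have hev : ∀ᶠ t in 𝓝 (0 : ℝ), χ q + t • w ∈ χ.target :=
      hlin.continuousAt.eventually_mem (χ.open_target.mem_nhds (by simpa using hqt))
    obtain ⟨ε, hε, hball⟩ := Metric.eventually_nhds_iff_ball.1 hev
    rw [Real.ball_eq_Ioo, zero_sub, zero_add] at hball
    refine ⟨ε, hε, fun t => χ.symm (χ q + t • w), ?_, fun t ht => ?_, ?_, ?_⟩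
    · exact h2.comp (by fun_prop) hball
    · refine (mem_iff_apply_mem_of_chart hχ (χ.map_target (hball t ht))).2 ?_
      rw [χ.right_inv (hball t ht)]
      exact W.add_mem ((mem_iff_apply_mem_of_chart hχ hq).1 hqN) (W.smul_mem t hu)
    · simp [χ.left_inv hq]
    · have hs : HasFDerivAt χ.symm (fderiv ℝ χ.symm (χ q)) (χ q) :=
        ((h2.contDiffAt (χ.open_target.mem_nhds hqt)).differentiableAt (by simp)).hasFDerivAt
      have hid : (fderiv ℝ χ.symm (χ q)).comp (fderiv ℝ χ q) = ContinuousLinearMap.id ℝ E := by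
        refine (hs.comp q hd).unique ((hasFDerivAt_id q).congr_of_eventuallyEq ?_)
        filter_upwards [χ.open_source.mem_nhds hq] with x hx using χ.left_inv hx
      have hl : HasDerivAt (fun t : ℝ => χ q + t • w) w 0 := by
        simpa using ((hasDerivAt_id (0 : ℝ)).smul_const w).const_add (χ q)
      have h3 : HasFDerivAt χ.symm (fderiv ℝ χ.symm (χ q)) (χ q + (0 : ℝ) • w) := by
        simpa using hs
      have h4 := (h3.comp_hasDerivAt (0 : ℝ) hl).deriv
      rw [hw, ← ContinuousLinearMap.comp_apply, hid] at h4
      exact h4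

/-- An embedded submanifold is locally the zero set of a smooth map whose derivative has the
tangent space as its kernel. -/
theorem IsEmbeddedSubmanifold.exists_definingFunction [CompleteSpace E] {N : Set E}
    (hN : IsEmbeddedSubmanifold N) {p : E} (hp : p ∈ N) :
    ∃ (U : Set E) (F : E → E), IsOpen U ∧ p ∈ U ∧ ContDiffOn ℝ ∞ F U ∧
      (∀ q ∈ U, q ∈ N → ∀ u, u ∈ tangentVectors N q ↔ fderiv ℝ F q u = 0) := by
  obtain ⟨χ, W, hW, hpχ, h1, h2, hχ⟩ := hN p hp
  have : CompleteSpace W := hW.completeSpace_coe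
  refine ⟨χ.source, fun x => Wᗮ.starProjection (χ x), χ.open_source, hpχ,
    (Wᗮ.starProjection).contDiff.comp_contDiffOn h1, fun q hq hqN u => ?_⟩
  have hd : HasFDerivAt χ (fderiv ℝ χ q) q :=
    ((h1.contDiffAt (χ.open_source.mem_nhds hq)).differentiableAt (by simp)).hasFDerivAt
  have h3 : HasFDerivAt (fun x => Wᗮ.starProjection (χ x)) _ q :=
    (Wᗮ.starProjection).hasFDerivAt.comp q hd
  rw [mem_tangentVectors_iff_of_chart hW h1 h2 hχ hq hqN, h3.fderiv,
    ContinuousLinearMap.comp_apply, Submodule.starProjection_orthogonal_val, sub_eq_zero, eq_comm,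
    Submodule.starProjection_eq_self_iff]

/-- The tangent vectors of an embedded submanifold at a point form a closed linear subspace. -/
theorem IsEmbeddedSubmanifold.exists_tangentSpace [CompleteSpace E] {N : Set E}
    (hN : IsEmbeddedSubmanifold N) {p : E} (hp : p ∈ N) :
    ∃ T : Submodule ℝ E, IsClosed (T : Set E) ∧ ∀ u, u ∈ T ↔ u ∈ tangentVectors N p := by
  obtain ⟨U, F, hU, hpU, hF, hT⟩ := hN.exists_definingFunction hp
  exact ⟨(fderiv ℝ F p).ker, (fderiv ℝ F p).isClosed_ker, fun u => (hT p hpU hp u).symm⟩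

theorem IsEmbeddedSubmanifold.isClosed_tangentBundle [CompleteSpace E] {N : Set E}
    (hN : IsEmbeddedSubmanifold N) (hc : IsClosed N) : IsClosed (tangentBundle N) := by
  refine isClosed_of_closure_subset fun x hx => ?_
  obtain ⟨y, hy, hlim⟩ := mem_closure_iff_seq_limit.1 hx
  have h1 : Filter.Tendsto (fun n => (y n).1) Filter.atTop (𝓝 x.1) :=
    (continuous_fst.tendsto x).comp hlim
  have h2 : Filter.Tendsto (fun n => (y n).2) Filter.atTop (𝓝 x.2) :=
    (continuous_snd.tendsto x).comp hlim
  have hxN : x.1 ∈ N := hc.mem_of_tendsto h1 (Filter.Eventually.of_forall fun n => (hy n).1)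
  obtain ⟨U, F, hU, hpU, hF, hT⟩ := hN.exists_definingFunction hxN
  refine ⟨hxN, (hT _ hpU hxN _).2 ?_⟩
  have hcont : ContinuousAt (fderiv ℝ F) x.1 :=
    (hF.continuousOn_fderiv_of_isOpen hU (by simp)).continuousAt (hU.mem_nhds hpU)
  have h3 : Filter.Tendsto (fun n => fderiv ℝ F (y n).1 (y n).2) Filter.atTop
      (𝓝 (fderiv ℝ F x.1 x.2)) := 
    ((isBoundedBilinearMap_apply (𝕜 := ℝ) (E := E) (F := E)).continuous.tendsto
      (fderiv ℝ F x.1, x.2)).comp ((hcont.tendsto.comp h1).prodMk_nhds h2)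
  refine tendsto_nhds_unique h3 (tendsto_const_nhds.congr' ?_)
  filter_upwards [h1.eventually_mem (hU.mem_nhds hpU)] with n hn
  exact ((hT _ hn (hy n).1 _).1 (hy n).2).symm

/-- Two curves in `N` with the same velocity at a point have accelerations there that differ by a
tangent vector. -/
theorem IsEmbeddedSubmanifold.deriv_deriv_sub_mem [CompleteSpace E] {N : Set E}
    (hN : IsEmbeddedSubmanifold N) {c d : ℝ → E} (hc : ContDiff ℝ ∞ c) (hd : ContDiff ℝ ∞ d)
    (hcN : ∀ t, c t ∈ N) (hdN : ∀ t, d t ∈ N) (h0 : c 0 = d 0) (h1 : deriv c 0 = deriv d 0) :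
    deriv (deriv c) 0 - deriv (deriv d) 0 ∈ tangentVectors N (c 0) := by
  obtain ⟨U, F, hU, hpU, hF, hT⟩ := hN.exists_definingFunction (hcN 0)
  have hF' : HasFDerivAt (fderiv ℝ F) (fderiv ℝ (fderiv ℝ F) (c 0)) (c 0) :=
    (((hF.contDiffAt (hU.mem_nhds hpU)).fderiv_right (m := ∞) (by simp)).differentiableAt
      (by simp)).hasFDerivAt
  have key : ∀ e : ℝ → E, ContDiff ℝ ∞ e → (∀ t, e t ∈ N) → e 0 = c 0 →
      fderiv ℝ (fderiv ℝ F) (c 0) (deriv e 0) (deriv e 0) +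
        fderiv ℝ F (c 0) (deriv (deriv e) 0) = 0 := by
    intro e he heN he0
    have he1 : HasDerivAt e (deriv e 0) 0 := (he.differentiable (by simp) 0).hasDerivAt
    have he2 : HasDerivAt (deriv e) (deriv (deriv e) 0) 0 :=
      ((contDiff_infty_iff_deriv.1 he).2.differentiable (by simp) 0).hasDerivAt
    rw [← he0] at hF'
    have h3 := (hF'.comp_hasDerivAt (0 : ℝ) he1).clm_apply he2
    have h4 : (fun t => (fderiv ℝ F ∘ e) t (deriv e t)) =ᶠ[𝓝 0] fun _ => 0 := by
      filter_upwards [he1.continuousAt.eventually_mem (hU.mem_nhds (by rwa [he0]))] with t ht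
      exact (hT _ ht (heN t) _).1 (deriv_mem_tangentVectors he heN t)
    have h5 := (h3.congr_of_eventuallyEq h4.symm).unique (hasDerivAt_const (0 : ℝ) (0 : E))
    rw [Function.comp_apply, he0] at h5
    exact h5
  refine (hT _ hpU (hcN 0) _).2 ?_
  have e1 := key c hc hcN rfl
  have e2 := key d hd hdN h0.symm
  rw [← h1] at e2
  rw [map_sub, sub_eq_zero]
  exact add_left_cancel (e1.trans e2.symm)

/-- A map into `N` whose derivative is onto the tangent space covers a neighbourhood in `N`. -/
theorem IsEmbeddedSubmanifold.eventually_mem_range [CompleteSpace E] {N : Set E}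
    (hN : IsEmbeddedSubmanifold N) {Z : Type*} [NormedAddCommGroup Z] [NormedSpace ℝ Z]
    [CompleteSpace Z] {e : Z → E} {e' : Z →L[ℝ] E} (he : HasStrictFDerivAt e e' 0)
    (heN : ∀ᶠ z in 𝓝 0, e z ∈ N) (hsurj : ∀ u ∈ tangentVectors N (e 0), ∃ z, e' z = u) :
    ∀ᶠ q in 𝓝 (e 0), q ∈ N → q ∈ range e := by
  have hpN : e 0 ∈ N := heN.self_of_nhds
  obtain ⟨χ, W, hW, hpχ, h1, h2, hχ⟩ := hN _ hpN
  have : CompleteSpace W := hW.completeSpace_coe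
  have hχd : HasStrictFDerivAt χ (fderiv ℝ χ (e 0)) (e 0) :=
    (h1.contDiffAt (χ.open_source.mem_nhds hpχ)).hasStrictFDerivAt (by simp)
  let P : E →L[ℝ] W := W.orthogonalProjectionOnto
  have hψ : HasStrictFDerivAt (fun z => P (χ (e z))) (P.comp ((fderiv ℝ χ (e 0)).comp e')) 0 :=
    P.hasStrictFDerivAt.comp 0 (hχd.comp 0 he)
  have honto : (P.comp ((fderiv ℝ χ (e 0)).comp e')).range = ⊤ := by
    refine LinearMap.range_eq_top.2 fun w => ?_
    have hs : HasFDerivAt χ.symm (fderiv ℝ χ.symm (χ (e 0))) (χ (e 0)) :=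
      ((h2.contDiffAt (χ.open_target.mem_nhds (χ.map_source hpχ))).differentiableAt
        (by simp)).hasFDerivAt
    have hs' : χ.symm (χ (e 0)) = e 0 := χ.left_inv hpχ
    have hid : (fderiv ℝ χ (e 0)).comp (fderiv ℝ χ.symm (χ (e 0))) =
        ContinuousLinearMap.id ℝ E := by
      have hd : HasFDerivAt χ (fderiv ℝ χ (e 0)) (χ.symm (χ (e 0))) := by
        rw [hs']; exact hχd.hasFDerivAt
      refine (hd.comp _ hs).unique ((hasFDerivAt_id _).congr_of_eventuallyEq ?_)
      filter_upwards [χ.open_target.mem_nhds (χ.map_source hpχ)] with x hx using χ.right_inv hx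
    have hw : fderiv ℝ χ (e 0) (fderiv ℝ χ.symm (χ (e 0)) w) = w :=
      congrArg (fun L : E →L[ℝ] E => L w) hid
    obtain ⟨z, hz⟩ := hsurj (fderiv ℝ χ.symm (χ (e 0)) w)
      ((mem_tangentVectors_iff_of_chart hW h1 h2 hχ hpχ hpN).2 (by rw [hw]; exact w.2))
    refine ⟨z, ?_⟩
    change P (fderiv ℝ χ (e 0) (e' z)) = w
    rw [hz, hw]
    exact W.orthogonalProjectionOnto_mem_subspace_eq_self w
  have hmap := hψ.map_nhds_eq_of_surj honto
  have hev : ∀ᶠ z in 𝓝 (0 : Z), e z ∈ N ∧ e z ∈ χ.source :=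
    heN.and (he.hasFDerivAt.continuousAt.eventually_mem (χ.open_source.mem_nhds hpχ))
  have himg : (fun z => P (χ (e z))) '' {z | e z ∈ N ∧ e z ∈ χ.source} ∈ 𝓝 (P (χ (e 0))) := by
    rw [← hmap]; exact Filter.image_mem_map hev
  have hcont : ContinuousAt (fun q => P (χ q)) (e 0) :=
    P.continuous.continuousAt.comp hχd.hasFDerivAt.continuousAt
  filter_upwards [hcont.eventually_mem himg, χ.open_source.mem_nhds hpχ] with q hq hqs hqN
  obtain ⟨z, ⟨hzN, hzs⟩, hz⟩ := hq
  refine ⟨z, χ.injOn hzs hqs ?_⟩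
  have e1 : ((P (χ (e z)) : W) : E) = χ (e z) :=
    W.starProjection_eq_self_iff.2 ((mem_iff_apply_mem_of_chart hχ hzs).1 hzN)
  have e2 : ((P (χ q) : W) : E) = χ q :=
    W.starProjection_eq_self_iff.2 ((mem_iff_apply_mem_of_chart hχ hqs).1 hqN)
  rw [← e1, ← e2]
  exact congrArg Subtype.val hz

end Embedded

/-! ### Magnetic geodesics of the unit sphere -/

section Geodesics

variable {H : Type*} [NormedAddCommGroup H] [InnerProductSpace ℂ H]

/-- A curve on the unit sphere with `γ'' = i γ' + k γ` is a magnetic geodesic: the tangential part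
of its acceleration is the tangential part of `i γ'`, which is the Lorentz force. -/
theorem isMagneticGeodesicOn_univ {γ : ℝ → H} (hγ : ContDiff ℝ ∞ γ)
    (hS : ∀ t, γ t ∈ unitSphere H)
    (heq : ∀ t, ∃ k : ℝ, deriv (deriv γ) t = Complex.I • deriv γ t + k • γ t) :
    IsMagneticGeodesicOn (unitSphere H) (dContactForm H) γ univ where
  smooth := hγ.contDiffOn
  mem t _ := hS t
  equation t _ := by
    obtain ⟨k, hk⟩ := heq t
    have ht : ∀ {v}, v ∈ tangentVectors (unitSphere H) (γ t) ↔ inner ℝ (γ t) v = 0 :=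
      mem_tangentVectors_unitSphere (hS t)
    have ha : Complex.I • deriv γ t - (inner ℝ (γ t) (Complex.I • deriv γ t) : ℝ) • γ t ∈
        tangentVectors (unitSphere H) (γ t) := by
      rw [ht, inner_sub_right, real_inner_smul_right, inner_self_of_mem_unitSphere (hS t)]
      ring
    refine ⟨_, ⟨ha, fun v hv => ?_⟩, ha, fun v hv => ?_⟩
    · rw [hk]
      simp only [inner_sub_left, inner_add_left, real_inner_smul_left, ht.1 hv]
      ring
    · rw [dContactForm_apply, inner_sub_left, real_inner_smul_left, ht.1 hv]
      ring

theorem IsMagneticGeodesicOn.deriv_deriv_eq {γ : ℝ → H} {I : Set ℝ}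
    (hγ : IsMagneticGeodesicOn (unitSphere H) (dContactForm H) γ I) {t : ℝ} (ht : t ∈ I) :
    deriv (deriv γ) t = Complex.I • deriv γ t +
      (inner ℝ (γ t) (deriv (deriv γ) t - Complex.I • deriv γ t) : ℝ) • γ t := by
  obtain ⟨a, ⟨ha, h1⟩, -, h2⟩ := hγ.equation t ht
  have hS := hγ.mem t ht
  have hT : ∀ {v}, v ∈ tangentVectors (unitSphere H) (γ t) ↔ inner ℝ (γ t) v = 0 :=
    mem_tangentVectors_unitSphere hS
  obtain ⟨x, hx⟩ : ∃ x, x = deriv (deriv γ) t - Complex.I • deriv γ t := ⟨_, rfl⟩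
  have hz : inner ℝ (γ t) (x - (inner ℝ (γ t) x : ℝ) • γ t) = 0 := by
    rw [inner_sub_right, real_inner_smul_right, inner_self_of_mem_unitSphere hS]
    ring
  have e1 := h1 _ (hT.2 hz)
  have e2 := h2 _ (hT.2 hz)
  rw [dContactForm_apply] at e2
  have e3 : inner ℝ (x - (inner ℝ (γ t) x : ℝ) • γ t) (x - (inner ℝ (γ t) x : ℝ) • γ t) = 0 := by
    rw [inner_sub_left, real_inner_smul_left, hz, mul_zero, sub_zero, hx, inner_sub_left, ← hx,
      ← e2, ← inner_sub_left, e1]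
  rw [inner_self_eq_zero, sub_eq_zero] at e3
  rw [← hx, ← e3, hx]
  abel

/-- The rotation by `e^{i t / 2}`. -/
noncomputable def halfPhase (t : ℝ) : ℂ := Complex.exp ((t / 2 : ℝ) * Complex.I)

theorem norm_halfPhase (t : ℝ) : ‖halfPhase t‖ = 1 := Complex.norm_exp_ofReal_mul_I _

theorem halfPhase_zero : halfPhase 0 = 1 := by simp [halfPhase]

theorem hasDerivAt_halfPhase (t : ℝ) :
    HasDerivAt halfPhase (halfPhase t * (Complex.I / 2)) t := by
  have h : HasDerivAt (fun s : ℝ => ((s / 2 : ℝ) : ℂ) * Complex.I) (Complex.I / 2) t := by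
    have := (((hasDerivAt_id t).div_const 2).ofReal_comp).mul_const Complex.I
    refine this.congr_deriv ?_
    simp; ring
  exact h.cexp

theorem contDiff_halfPhase : ContDiff ℝ ∞ halfPhase :=
  ((Complex.ofRealCLM.contDiff.comp (contDiff_id.div_const 2)).mul contDiff_const).cexp

theorem hasDerivAt_halfPhase_smul {X : ℝ → H} {X' : H} {t : ℝ} (hX : HasDerivAt X X' t) :
    HasDerivAt (fun t => halfPhase t • X t)
      (halfPhase t • ((Complex.I / 2) • X t + X')) t := by
  refine ((hasDerivAt_halfPhase t).smul hX).congr_deriv ?_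
  rw [smul_add, smul_smul, add_comm]

/-- The curve `e^{i t / 2} (cos (a t) p + sin (a t) w)`. For orthonormal `p` and `w` it is the
magnetic geodesic through `p` with velocity `i p / 2 + a w`. -/
noncomputable def magneticCurve (p w : H) (a t : ℝ) : H := halfPhase t • greatCircle p w (a * t)

theorem magneticCurve_zero (p w : H) (a : ℝ) : magneticCurve p w a 0 = p := by
  simp [magneticCurve, halfPhase_zero]

theorem contDiff_magneticCurve (p w : H) (a : ℝ) : ContDiff ℝ ∞ (magneticCurve p w a) :=
  contDiff_halfPhase.smul ((contDiff_greatCircle p w).comp (contDiff_const.mul contDiff_id))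

theorem magneticCurve_mem {p w : H} (hp : p ∈ unitSphere H) (hw : w ∈ unitSphere H)
    (hpw : inner ℝ p w = 0) (a t : ℝ) : magneticCurve p w a t ∈ unitSphere H := by
  rw [mem_unitSphere, magneticCurve, norm_smul, norm_halfPhase,
    mem_unitSphere.1 (greatCircle_mem hp hw hpw _), one_mul]

theorem hasDerivAt_greatCircle_mul (p w : H) (a t : ℝ) :
    HasDerivAt (fun t => greatCircle p w (a * t))
      (a • (-Real.sin (a * t) • p + Real.cos (a * t) • w)) t := by
  have h1 : HasDerivAt (fun t : ℝ => a * t) a t := by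
    simpa using (hasDerivAt_id t).const_mul a
  exact (hasDerivAt_greatCircle p w (a * t)).scomp t h1

theorem deriv_magneticCurve (p w : H) (a : ℝ) :
    deriv (magneticCurve p w a) = fun t => halfPhase t •
      ((Complex.I / 2) • greatCircle p w (a * t) + a • greatCircle w (-p) (a * t)) := by
  funext t
  refine (hasDerivAt_halfPhase_smul (hasDerivAt_greatCircle_mul p w a t)).deriv.trans ?_
  simp only [greatCircle, smul_neg, neg_smul]
  rw [add_comm (-(Real.sin (a * t) • p))]

theorem deriv_magneticCurve_zero (p w : H) (a : ℝ) :
    deriv (magneticCurve p w a) 0 = (1 / 2 : ℝ) • Complex.I • p + a • w := by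
  rw [deriv_magneticCurve]
  have h : (Complex.I / 2) • p = (1 / 2 : ℝ) • Complex.I • p := by
    rw [← Complex.coe_smul, smul_smul]; congr 1; push_cast; ring
  simp [halfPhase_zero, h]

theorem deriv_deriv_magneticCurve (p w : H) (a t : ℝ) :
    deriv (deriv (magneticCurve p w a)) t =
      Complex.I • deriv (magneticCurve p w a) t + (1 / 4 - a ^ 2) • magneticCurve p w a t := by
  have h1 := hasDerivAt_greatCircle_mul p w a t
  have h2 := hasDerivAt_greatCircle_mul w (-p) a t
  have h := hasDerivAt_halfPhase_smul ((h1.const_smul (Complex.I / 2)).fun_add (h2.const_smul a))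
  rw [deriv_magneticCurve, magneticCurve]
  refine h.deriv.trans ?_
  simp only [Pi.smul_apply]
  obtain ⟨x, hx⟩ : ∃ x, x = greatCircle p w (a * t) := ⟨_, rfl⟩
  obtain ⟨y, hy⟩ : ∃ y, y = greatCircle w (-p) (a * t) := ⟨_, rfl⟩
  have e1 : -Real.sin (a * t) • p + Real.cos (a * t) • w = y := by
    rw [hy, greatCircle, smul_neg, neg_smul, add_comm]
  have e2 : -Real.sin (a * t) • w + Real.cos (a * t) • -p = -x := by
    rw [hx, greatCircle, smul_neg, neg_smul, neg_add, add_comm]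
  simp only [e1, e2, ← hx, ← hy]
  rw [smul_comm Complex.I (halfPhase t), smul_comm (1 / 4 - a ^ 2 : ℝ) (halfPhase t), ← smul_add]
  congr 1
  simp only [← Complex.coe_smul]
  have hI : Complex.I * Complex.I = -1 := Complex.I_mul_I
  match_scalars
  · linear_combination (-1 / 4) * hI
  · ring

/-- Every tangent vector of the unit sphere is the velocity of one of the curves
`magneticCurve`. -/
theorem exists_magneticCurve {p u : H} (hp : p ∈ unitSphere H) (hu : inner ℝ p u = 0) :
    ∃ w ∈ unitSphere H, inner ℝ p w = 0 ∧ ∃ a, deriv (magneticCurve p w a) 0 = u := by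
  have h : inner ℝ p (u - (1 / 2 : ℝ) • Complex.I • p) = 0 := by
    rw [inner_sub_right, real_inner_smul_right, inner_self_I_smul, hu]; ring
  obtain ⟨w, hw, hpw, a, -, ha⟩ := exists_unit_smul_eq hp h
  exact ⟨w, hw, hpw, a, by rw [deriv_magneticCurve_zero, ← ha]; abel⟩

end Geodesics

/-! ### Closed totally magnetic submanifolds of the unit sphere -/

section TotallyMagnetic

variable {H : Type*} [NormedAddCommGroup H] [InnerProductSpace ℂ H] [CompleteSpace H]

/-- A magnetic geodesic that starts tangentially to a closed totally magnetic submanifold stays in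
it for all times: the times of tangency form a closed and open set. -/
theorem IsTotallyMagnetic.mem_of_geodesic {N : Set H} (hN : IsEmbeddedSubmanifold N)
    (hcl : IsClosed N)
    (hm : IsTotallyMagnetic (unitSphere H) (dContactForm H) N) {c : ℝ → H} (hc : ContDiff ℝ ∞ c)
    (hS : ∀ t, c t ∈ unitSphere H)
    (heq : ∀ t, ∃ k : ℝ, deriv (deriv c) t = Complex.I • deriv c t + k • c t)
    (h0 : c 0 ∈ N) (h1 : deriv c 0 ∈ tangentVectors N (c 0)) (t : ℝ) : c t ∈ N := by
  have hc' : ContDiff ℝ ∞ (deriv c) := (contDiff_infty_iff_deriv.1 hc).2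
  have hclosed : IsClosed {t | (c t, deriv c t) ∈ tangentBundle N} :=
    (hN.isClosed_tangentBundle hcl).preimage (hc.continuous.prodMk hc'.continuous)
  have hopen : IsOpen {t | (c t, deriv c t) ∈ tangentBundle N} := by
    rw [Metric.isOpen_iff]
    rintro t₀ ⟨ha, hb⟩
    have hd : deriv (fun s => c (s + t₀)) = fun s => deriv c (s + t₀) :=
      funext fun s => deriv_comp_add_const c t₀ s
    have hd2 : deriv (fun s => deriv c (s + t₀)) = fun s => deriv (deriv c) (s + t₀) :=
      funext fun s => deriv_comp_add_const (deriv c) t₀ s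
    have hshift : ContDiff ℝ ∞ (fun s => c (s + t₀)) :=
      hc.comp (contDiff_id.add contDiff_const)
    obtain ⟨ε, hε, -, hstay⟩ := hm univ (fun s => c (s + t₀)) isOpen_univ ordConnected_univ
      (mem_univ _) (isMagneticGeodesicOn_univ hshift (fun s => hS _) fun s => by
        rw [hd, hd2]; exact heq _) (by simpa using ha) (by rw [hd]; simpa using hb)
    refine ⟨ε, hε, fun t ht => ?_⟩
    rw [Real.ball_eq_Ioo] at ht
    have hin : ∀ s ∈ Ioo (-ε) ε, c (s + t₀) ∈ N := hstay
    refine ⟨by simpa using hin (t - t₀) ⟨by linarith [ht.1], by linarith [ht.2]⟩,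
      min (t - t₀ + ε) (ε - (t - t₀)), lt_min (by linarith [ht.1]) (by linarith [ht.2]),
      fun s => c (s + t), (hc.comp (contDiff_id.add contDiff_const)).contDiffOn, fun s hs => ?_,
      by simp, by rw [deriv_comp_add_const]; simp⟩
    have e1 := min_le_left (t - t₀ + ε) (ε - (t - t₀))
    have e2 := min_le_right (t - t₀ + ε) (ε - (t - t₀))
    have := hin (s + (t - t₀)) ⟨by linarith [hs.1], by linarith [hs.2]⟩
    rwa [add_assoc, sub_add_cancel] at this
  have huniv := IsClopen.eq_univ ⟨hclosed, hopen⟩ ⟨0, h0, h1⟩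
  exact (huniv.symm ▸ mem_univ t : t ∈ {t | (c t, deriv c t) ∈ tangentBundle N}).1

theorem inner_eq_zero_of_mem_tangentVectors {H : Type*} [NormedAddCommGroup H]
    [InnerProductSpace ℂ H] {N : Set H} (hNS : N ⊆ unitSphere H) {p u : H} (hp : p ∈ N)
    (hu : u ∈ tangentVectors N p) : inner ℝ p u = 0 :=
  (mem_tangentVectors_unitSphere (hNS hp)).1 (tangentVectors_mono hNS p hu)

variable {N : Set H} (hN : IsEmbeddedSubmanifold N) (hcl : IsClosed N) (hNS : N ⊆ unitSphere H)
  (hm : IsTotallyMagnetic (unitSphere H) (dContactForm H) N)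

include hN hcl hNS hm

theorem IsTotallyMagnetic.magneticCurve_mem {p w : H} (hp : p ∈ N) (hw : w ∈ unitSphere H)
    (hpw : inner ℝ p w = 0) {a : ℝ} (hT : deriv (magneticCurve p w a) 0 ∈ tangentVectors N p)
    (t : ℝ) : magneticCurve p w a t ∈ N :=
  hm.mem_of_geodesic hN hcl (contDiff_magneticCurve p w a)
    (Magnetic.magneticCurve_mem (hNS hp) hw hpw a)
    (fun t => ⟨_, deriv_deriv_magneticCurve p w a t⟩) (by rwa [magneticCurve_zero])
    (by rwa [magneticCurve_zero]) t

/-- The tangent spaces of `N` are invariant under the Lorentz force. This comes from comparing the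
geodesics with velocities `u` and `2 u`: parametrized to have the same velocity, their
accelerations differ in the magnetic term. -/
theorem IsTotallyMagnetic.lorentz_mem {p u : H} (hp : p ∈ N) (hu : u ∈ tangentVectors N p) :
    Complex.I • u - (inner ℝ p (Complex.I • u) : ℝ) • p ∈ tangentVectors N p := by
  have hpS := hNS hp
  have hpu := inner_eq_zero_of_mem_tangentVectors hNS hp hu
  obtain ⟨T, -, hT⟩ := hN.exists_tangentSpace hp
  obtain ⟨w, hw, hpw, a, ha⟩ := exists_magneticCurve hpS hpu
  obtain ⟨w', hw', hpw', b, hb⟩ := exists_magneticCurve (u := (2 : ℝ) • u) hpS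
    (by rw [real_inner_smul_right, hpu, mul_zero])
  have hd1 : deriv (fun t => magneticCurve p w' b ((1 / 2 : ℝ) * t)) =
      fun t => (1 / 2 : ℝ) • deriv (magneticCurve p w' b) ((1 / 2 : ℝ) * t) :=
    funext fun t => deriv_comp_mul_left (1 / 2 : ℝ) (magneticCurve p w' b) t
  have hd2 : deriv (deriv (fun t => magneticCurve p w' b ((1 / 2 : ℝ) * t))) 0 =
      (1 / 4 : ℝ) • deriv (deriv (magneticCurve p w' b)) 0 := by
    rw [hd1, deriv_fun_const_smul_field, deriv_comp_mul_left (1 / 2 : ℝ), smul_smul, mul_zero]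
    norm_num
  have hdc : ContDiff ℝ ∞ fun t => magneticCurve p w' b ((1 / 2 : ℝ) * t) :=
    (contDiff_magneticCurve p w' b).comp (contDiff_const.mul contDiff_id)
  have h := hN.deriv_deriv_sub_mem (contDiff_magneticCurve p w a) hdc
    (hm.magneticCurve_mem hN hcl hNS hp hw hpw (by rwa [ha]))
    (fun t => hm.magneticCurve_mem hN hcl hNS hp hw' hpw' (by
      rw [hb, ← hT]; exact T.smul_mem 2 ((hT u).2 hu)) _)
    (by simp [magneticCurve_zero])
    (by rw [hd1]; simp only [mul_zero]; rw [ha, hb, smul_smul]; norm_num)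
  rw [hd2, deriv_deriv_magneticCurve, deriv_deriv_magneticCurve, ha, hb, magneticCurve_zero,
    magneticCurve_zero] at h
  obtain ⟨k, hk⟩ : ∃ k : ℝ, (1 / 2 : ℝ) • Complex.I • u + k • p ∈ tangentVectors N p := by
    refine ⟨(1 / 4 - a ^ 2) - 1 / 4 * (1 / 4 - b ^ 2), ?_⟩
    convert h using 1
    rw [smul_comm Complex.I (2 : ℝ) u]
    module
  have hk0 := inner_eq_zero_of_mem_tangentVectors hNS hp hk
  rw [inner_add_right, real_inner_smul_right, real_inner_smul_right,
    inner_self_of_mem_unitSphere hpS] at hk0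
  have hk' : k = -(1 / 2) * inner ℝ p (Complex.I • u) := by linarith
  rw [← hT] at hk ⊢
  convert T.smul_mem 2 hk using 1
  rw [hk']
  module

/-- A tangent vector with a component along the fibre of the Hopf fibration splits it off. -/
theorem IsTotallyMagnetic.reeb_component_mem {p u : H} (hp : p ∈ N)
    (hu : u ∈ tangentVectors N p) :
    (inner ℝ (Complex.I • p) u : ℝ) • Complex.I • p ∈ tangentVectors N p := by
  obtain ⟨T, -, hT⟩ := hN.exists_tangentSpace hp
  have hpu := inner_eq_zero_of_mem_tangentVectors hNS hp hu
  have h1 := hm.lorentz_mem hN hcl hNS hp hu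
  have h2 := hm.lorentz_mem hN hcl hNS hp h1
  have e1 : inner ℝ p (Complex.I • u) = -inner ℝ (Complex.I • p) u := by
    rw [inner_I_smul_left_eq_neg, neg_neg]
  rw [e1, neg_smul, sub_neg_eq_add, smul_add, smul_smul, Complex.I_mul_I, neg_one_smul,
    inner_add_right, inner_neg_right, hpu, smul_comm, real_inner_smul_right,
    inner_self_I_smul, mul_zero, neg_zero, add_zero, zero_smul, sub_zero] at h2
  rw [← hT] at h2 hu ⊢
  simpa using T.add_mem h2 hu

/-- The Reeb direction `i p` is tangent to `N`. If a nonzero tangent vector `u` is orthogonal to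
it, then the geodesics with velocities `e^{iθ} u` reach points `q` arbitrarily close to `p`, and
varying `θ` gives a tangent vector at `q` that has a component along `i q`. -/
theorem IsTotallyMagnetic.reeb_mem (hpos : HasPositiveDimension N) {p : H} (hp : p ∈ N) :
    Complex.I • p ∈ tangentVectors N p := by
  have hpS := hNS hp
  obtain ⟨u, hu, hu0⟩ := hpos p hp
  have hpu := inner_eq_zero_of_mem_tangentVectors hNS hp hu
  have hreeb : ∀ q ∈ N, ∀ v ∈ tangentVectors N q, inner ℝ (Complex.I • q) v ≠ 0 →
      Complex.I • q ∈ tangentVectors N q := by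
    intro q hq v hv hne
    obtain ⟨T, -, hT⟩ := hN.exists_tangentSpace hq
    have h := hm.reeb_component_mem hN hcl hNS hq hv
    rw [← hT] at h ⊢
    have := T.smul_mem (inner ℝ (Complex.I • q) v : ℝ)⁻¹ h
    rwa [smul_smul, inv_mul_cancel₀ hne, one_smul] at this
  by_cases ha : inner ℝ (Complex.I • p) u = 0
  swap
  · exact hreeb p hp u hu ha
  have hpIu : inner ℝ p (Complex.I • u) = 0 := by
    rw [inner_I_smul_left_eq_neg] at ha; linarith
  obtain ⟨T, -, hT⟩ := hN.exists_tangentSpace hp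
  have hIu : Complex.I • u ∈ tangentVectors N p := by
    have h := hm.lorentz_mem hN hcl hNS hp hu
    rwa [hpIu, zero_smul, sub_zero] at h
  have hnu : 0 < inner ℝ u u := by
    rw [real_inner_self_eq_norm_sq]; exact pow_pos (norm_pos_iff.2 hu0) 2
  have huIp : inner ℝ u (Complex.I • p) = 0 := by rw [real_inner_comm, ha]
  have hIuIp : inner ℝ (Complex.I • u) (Complex.I • p) = 0 := by
    rw [inner_I_smul_I_smul, real_inner_comm, hpu]
  have hIpIp : inner ℝ (Complex.I • p) (Complex.I • p) = 1 := by
    rw [inner_I_smul_I_smul, inner_self_of_mem_unitSphere hpS]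
  have hIuIu : inner ℝ (Complex.I • u) (Complex.I • u) = inner ℝ u u := inner_I_smul_I_smul u u
  have huIu := inner_self_I_smul u
  have hIuu : inner ℝ (Complex.I • u) u = 0 := by rw [real_inner_comm, huIu]
  have hIpIu : inner ℝ (Complex.I • p) (Complex.I • u) = 0 := by rw [real_inner_comm, hIuIp]
  -- the common angular speed of the geodesics with velocities `e^{iθ} u`
  obtain ⟨r, hr, hr2⟩ : ∃ r : ℝ, 0 < r ∧ r * r = inner ℝ u u + 1 / 4 :=
    ⟨Real.sqrt (inner ℝ u u + 1 / 4), Real.sqrt_pos.2 (by linarith),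
      Real.mul_self_sqrt (by linarith)⟩
  obtain ⟨w, hwdef⟩ : ∃ w : ℝ → H, w = fun θ => r⁻¹ •
    (Real.cos θ • u + Real.sin θ • Complex.I • u - (1 / 2 : ℝ) • Complex.I • p) := ⟨_, rfl⟩
  have hw : ∀ θ, w θ ∈ unitSphere H := by
    intro θ
    have h : inner ℝ (Real.cos θ • u + Real.sin θ • Complex.I • u - (1 / 2 : ℝ) • Complex.I • p)
        (Real.cos θ • u + Real.sin θ • Complex.I • u - (1 / 2 : ℝ) • Complex.I • p) =
        r * r := by
      simp only [inner_sub_left, inner_sub_right, inner_add_left, inner_add_right,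
        real_inner_smul_left, real_inner_smul_right, huIp, hIuIp, hIpIp, hIuIu, huIu, hIuu, ha,
        hIpIu, hr2]
      linear_combination inner ℝ u u * Real.cos_sq_add_sin_sq θ
    rw [mem_unitSphere_iff_inner, hwdef]
    simp only
    rw [real_inner_smul_left, real_inner_smul_right, h]
    field_simp
  have hpw : ∀ θ, inner ℝ p (w θ) = 0 := by
    intro θ
    rw [hwdef]
    simp only [real_inner_smul_right, inner_sub_right, inner_add_right, hpu, hpIu,
      inner_self_I_smul]
    ring
  have hmem : ∀ θ t, magneticCurve p (w θ) r t ∈ N := by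
    intro θ t
    refine hm.magneticCurve_mem hN hcl hNS hp (hw θ) (hpw θ) ?_ t
    rw [deriv_magneticCurve_zero, hwdef]
    simp only
    rw [smul_smul, mul_inv_cancel₀ hr.ne', one_smul, add_sub_cancel, ← hT]
    exact T.add_mem (T.smul_mem _ ((hT _).2 hu)) (T.smul_mem _ ((hT _).2 hIu))
  have hwd : HasDerivAt w (r⁻¹ • Complex.I • u) 0 := by
    have h := ((((Real.hasDerivAt_cos 0).smul_const u).fun_add
      ((Real.hasDerivAt_sin 0).smul_const (Complex.I • u))).sub_const
        ((1 / 2 : ℝ) • Complex.I • p)).const_smul r⁻¹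
    rw [hwdef]
    refine h.congr_deriv ?_
    simp
  have hwc : ContDiff ℝ ∞ w := by
    rw [hwdef]
    exact contDiff_const.smul (((Real.contDiff_cos.smul contDiff_const).add
      (Real.contDiff_sin.smul contDiff_const)).sub contDiff_const)
  have htan : ∀ t, halfPhase t • Real.sin (r * t) • r⁻¹ • Complex.I • u ∈
      tangentVectors N (magneticCurve p (w 0) r t) := by
    intro t
    refine mem_tangentVectors_of_hasDerivAt (c := fun θ => magneticCurve p (w θ) r t)
      (contDiff_const.smul (contDiff_const.add (contDiff_const.smul hwc))) (fun θ => hmem θ t)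
      rfl ?_
    exact ((hwd.const_smul (Real.sin (r * t))).const_add (Real.cos (r * t) • p)).const_smul
      (halfPhase t)
  have hq : ∀ t ∈ Ioo 0 (Real.pi / r), (magneticCurve p (w 0) r t,
      Complex.I • magneticCurve p (w 0) r t) ∈ tangentBundle N := by
    intro t ht
    refine ⟨hmem 0 t, hreeb _ (hmem 0 t) _ (htan t) ?_⟩
    have hsin : 0 < Real.sin (r * t) := by
      refine Real.sin_pos_of_pos_of_lt_pi (mul_pos hr ht.1) ?_
      have := (lt_div_iff₀ hr).1 ht.2
      linarith
    have hE : ∀ x y : H, inner ℝ (halfPhase t • x) (halfPhase t • y) = inner ℝ x y := by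
      intro x y
      rw [real_inner_eq_re_inner ℂ, real_inner_eq_re_inner ℂ, inner_smul_left, inner_smul_right,
        ← mul_assoc, ← Complex.normSq_eq_conj_mul_self, Complex.normSq_eq_norm_sq, norm_halfPhase]
      simp
    rw [magneticCurve, smul_comm Complex.I (halfPhase t), hE, greatCircle, hwdef]
    simp only [Real.cos_zero, Real.sin_zero, one_smul, zero_smul, add_zero, smul_add, smul_sub,
      inner_sub_left, inner_add_left, smul_comm Complex.I (_ : ℝ), real_inner_smul_left,
      real_inner_smul_right, hIpIu, hIuIu]
    rw [smul_smul, Complex.I_mul_I, neg_one_smul, inner_neg_left, hpIu]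
    have : 0 < Real.sin (r * t) * (Real.sin (r * t) * (r⁻¹ * (r⁻¹ * inner ℝ u u))) := by
      positivity
    intro h0
    apply this.ne'
    linear_combination h0
  have hclosed : IsClosed {t | (magneticCurve p (w 0) r t,
      Complex.I • magneticCurve p (w 0) r t) ∈ tangentBundle N} :=
    (hN.isClosed_tangentBundle hcl).preimage
      ((contDiff_magneticCurve p (w 0) r).continuous.prodMk
        ((contDiff_magneticCurve p (w 0) r).continuous.const_smul Complex.I))
  have h0 := hclosed.closure_subset_iff.2 hq (show (0 : ℝ) ∈ closure (Ioo 0 (Real.pi / r)) by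
    have : (0 : ℝ) < Real.pi / r := by positivity
    rw [closure_Ioo this.ne]
    exact left_mem_Icc.2 this.le)
  have h1 := h0.2
  simpa only [magneticCurve_zero] using h1

end TotallyMagnetic

/-! ### Totally magnetic submanifolds are complex subspheres -/

section Subspheres

variable {H : Type*} [NormedAddCommGroup H] [InnerProductSpace ℂ H]

/-- A vector of a complex subspace `V` that is orthogonal to `q` is tangent at `q` to every set
containing the unit sphere of `V`. -/
theorem mem_tangentVectors_of_subset {N : Set H} {V : Submodule ℂ H}
    (hV : unitSphere H ∩ V ⊆ N) {q v : H} (hq : q ∈ unitSphere H) (hqV : q ∈ V) (hv : v ∈ V)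
    (hqv : inner ℝ q v = 0) : v ∈ tangentVectors N q := by
  obtain ⟨w, hw, hqw, a, -, rfl⟩ := exists_unit_smul_eq hq hqv
  by_cases ha : a = 0
  · subst ha
    rw [zero_smul]
    exact mem_tangentVectors_of_hasDerivAt (c := fun _ => q) contDiff_const
      (fun _ => hV ⟨hq, hqV⟩) rfl (hasDerivAt_const _ _)
  · have hwV : w ∈ V := by
      have := V.smul_of_tower_mem a⁻¹ hv
      rwa [smul_smul, inv_mul_cancel₀ ha, one_smul] at this
    refine mem_tangentVectors_of_hasDerivAt (c := fun t => greatCircle q w (a * t))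
      ((contDiff_greatCircle q w).comp (contDiff_const.mul contDiff_id)) (fun t => hV
        ⟨Magnetic.greatCircle_mem hq hw hqw _, V.add_mem (V.smul_of_tower_mem _ hqV)
          (V.smul_of_tower_mem _ hwV)⟩) (by simp) ?_
    simpa using hasDerivAt_greatCircle_mul q w a 0

/-- The radial projection `z ↦ (q + z) / ‖q + z‖` has the identity as its derivative at `0` on
vectors orthogonal to `q`. -/
theorem hasStrictFDerivAt_normalize {q : H} (hq : q ∈ unitSphere H) :
    ∃ L : H →L[ℝ] H, HasStrictFDerivAt (fun z => ‖q + z‖⁻¹ • (q + z)) L 0 ∧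
      ∀ u, inner ℝ q u = 0 → L u = u := by
  have hq0 : q + 0 ≠ 0 := by
    rw [add_zero]; rintro rfl; simp [mem_unitSphere] at hq
  have hadd : ContDiffAt ℝ ∞ (fun z : H => q + z) 0 := contDiffAt_const.add contDiffAt_id
  have hs : ContDiffAt ℝ ∞ (fun z : H => ‖q + z‖⁻¹ • (q + z)) 0 :=
    ((hadd.norm ℝ hq0).inv (norm_ne_zero_iff.2 hq0)).smul hadd
  refine ⟨_, hs.hasStrictFDerivAt (by simp), fun u hu => ?_⟩
  have hl : HasDerivAt (fun t : ℝ => t • u) u 0 := by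
    simpa using (hasDerivAt_id (0 : ℝ)).smul_const u
  have hs' : HasFDerivAt (fun z : H => ‖q + z‖⁻¹ • (q + z))
      (fderiv ℝ (fun z : H => ‖q + z‖⁻¹ • (q + z)) 0) ((0 : ℝ) • u) := by
    rw [zero_smul]; exact (hs.hasStrictFDerivAt (by simp)).hasFDerivAt
  have h1 := hs'.comp_hasDerivAt (0 : ℝ) hl
  have hnorm : ∀ t : ℝ, ‖q + t • u‖ = Real.sqrt (1 + t ^ 2 * ‖u‖ ^ 2) := fun t => by
    rw [← Real.sqrt_sq (norm_nonneg (q + t • u)), norm_add_sq_real, real_inner_smul_right, hu,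
      mem_unitSphere.1 hq, norm_smul, mul_pow, Real.norm_eq_abs, sq_abs]
    congr 1; ring
  have h2 : HasDerivAt (fun t : ℝ => ‖q + t • u‖⁻¹ • (q + t • u)) u 0 := by
    simp only [hnorm]
    have h3 : HasDerivAt (fun t : ℝ => 1 + t ^ 2 * ‖u‖ ^ 2) 0 0 := by
      simpa using (((hasDerivAt_id (0 : ℝ)).pow 2).mul_const (‖u‖ ^ 2)).const_add 1
    have h4 := (h3.sqrt (by simp)).fun_inv (by simp)
    refine (h4.fun_smul (hl.const_add q)).congr_deriv ?_
    simp
  exact h1.unique h2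

/-- A complex subspace whose unit sphere is closed is closed. -/
theorem isClosed_of_isClosed_inter {V : Submodule ℂ H}
    (h : IsClosed (unitSphere H ∩ (V : Set H))) : IsClosed (V : Set H) := by
  refine isClosed_of_closure_subset fun x hx => ?_
  by_cases hx0 : x = 0
  · rw [hx0]; exact V.zero_mem
  obtain ⟨y, hy, hlim⟩ := mem_closure_iff_seq_limit.1 hx
  have hn : ‖x‖ ≠ 0 := norm_ne_zero_iff.2 hx0
  have h1 : Filter.Tendsto (fun n => ‖y n‖⁻¹ • y n) Filter.atTop (𝓝 (‖x‖⁻¹ • x)) :=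
    (hlim.norm.inv₀ hn).smul hlim
  have h2 : ‖x‖⁻¹ • x ∈ unitSphere H ∩ (V : Set H) := by
    refine h.mem_of_tendsto h1 ?_
    filter_upwards [hlim.eventually_ne hx0] with n hn
    exact ⟨inv_norm_smul_mem_unitSphere hn, V.smul_of_tower_mem _ (hy n)⟩
  have h3 := V.smul_of_tower_mem ‖x‖ h2.2
  rwa [smul_smul, mul_inv_cancel₀ hn, one_smul] at h3

variable [CompleteSpace H]

section Rotation

variable {N : Set H} (hN : IsEmbeddedSubmanifold N) (hcl : IsClosed N) (hNS : N ⊆ unitSphere H)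
  (hm : IsTotallyMagnetic (unitSphere H) (dContactForm H) N) (hpos : HasPositiveDimension N)

include hN hcl hNS hm hpos

/-- `N` is invariant under multiplication by phases, because the Reeb orbits are magnetic
geodesics. -/
theorem IsTotallyMagnetic.phase_smul_mem {p : H} (hp : p ∈ N) (t : ℝ) :
    Complex.exp (t * Complex.I) • p ∈ N := by
  have hd : ∀ (y : H) (s : ℝ), HasDerivAt (fun s : ℝ => Complex.exp (s * Complex.I) • y)
      (Complex.exp (s * Complex.I) • Complex.I • y) s := by
    intro y s
    have h : HasDerivAt (fun s : ℝ => (s : ℂ) * Complex.I) Complex.I s := by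
      simpa using ((hasDerivAt_id s).ofReal_comp).mul_const Complex.I
    refine (h.cexp.smul_const y).congr_deriv ?_
    rw [smul_smul]
  have h1 : deriv (fun s : ℝ => Complex.exp (s * Complex.I) • p) =
      fun s : ℝ => Complex.exp (s * Complex.I) • Complex.I • p := funext fun s => (hd p s).deriv
  refine hm.mem_of_geodesic hN hcl (c := fun s : ℝ => Complex.exp (s * Complex.I) • p)
    ?_ (fun s => ?_) (fun s => ⟨0, ?_⟩) (by simpa using hp) ?_ t
  · exact ((Complex.ofRealCLM.contDiff.mul contDiff_const).cexp).smul contDiff_const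
  · rw [mem_unitSphere, norm_smul, Complex.norm_exp_ofReal_mul_I, one_mul,
      mem_unitSphere.1 (hNS hp)]
  · rw [h1, (hd (Complex.I • p) s).deriv, zero_smul, add_zero]
    exact smul_comm _ _ _
  · rw [h1]
    simpa using hm.reeb_mem hN hcl hNS hpos hp

/-- `N` is totally geodesic: up to a phase, the geodesic with velocity `i p / 2 + v` is the great
circle with velocity `v`. -/
theorem IsTotallyMagnetic.greatCircle_mem {p v : H} (hp : p ∈ N) (hv : v ∈ tangentVectors N p)
    (hv1 : v ∈ unitSphere H) (t : ℝ) : greatCircle p v t ∈ N := by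
  obtain ⟨T, -, hT⟩ := hN.exists_tangentSpace hp
  have h := hm.magneticCurve_mem hN hcl hNS (a := 1) hp hv1
    (inner_eq_zero_of_mem_tangentVectors hNS hp hv) (by
      rw [deriv_magneticCurve_zero, ← hT]
      exact T.add_mem (T.smul_mem _ ((hT _).2 (hm.reeb_mem hN hcl hNS hpos hp)))
        (T.smul_mem _ ((hT _).2 hv))) t
  have h2 := hm.phase_smul_mem hN hcl hNS hpos h (-(t / 2))
  rw [magneticCurve, halfPhase, smul_smul, ← Complex.exp_add, one_mul] at h2
  simpa using h2

/-- At each point `p` of `N` the space `ℝ p ⊕ T_p N` is a closed complex subspace whose unit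
sphere lies in `N`. -/
theorem IsTotallyMagnetic.exists_span {p : H} (hp : p ∈ N) :
    ∃ V : Submodule ℂ H, IsClosed (V : Set H) ∧ p ∈ V ∧
      (∀ x, x ∈ V ↔ x - (inner ℝ p x : ℝ) • p ∈ tangentVectors N p) ∧
      unitSphere H ∩ V ⊆ N := by
  obtain ⟨T, hTc, hT⟩ := hN.exists_tangentSpace hp
  have hpS := hNS hp
  have hreeb := (hT _).2 (hm.reeb_mem hN hcl hNS hpos hp)
  have hreal : ∀ (r : ℝ) (x : H), x - (inner ℝ p x : ℝ) • p ∈ T →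
      r • x - (inner ℝ p (r • x) : ℝ) • p ∈ T := by
    intro r x hx
    have := T.smul_mem r hx
    rwa [smul_sub, smul_smul, ← real_inner_smul_right] at this
  have hadd : ∀ x y : H, x - (inner ℝ p x : ℝ) • p ∈ T → y - (inner ℝ p y : ℝ) • p ∈ T →
      (x + y) - (inner ℝ p (x + y) : ℝ) • p ∈ T := by
    intro x y hx hy
    rw [inner_add_right, add_smul, add_sub_add_comm]
    exact T.add_mem hx hy
  have hI : ∀ x : H, x - (inner ℝ p x : ℝ) • p ∈ T →
      Complex.I • x - (inner ℝ p (Complex.I • x) : ℝ) • p ∈ T := by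
    intro x hx
    have h1 := (hT _).2 (hm.lorentz_mem hN hcl hNS hp ((hT _).1 hx))
    have h2 := T.add_mem h1 (T.smul_mem (inner ℝ p x : ℝ) hreeb)
    rw [smul_sub, inner_sub_right, smul_comm Complex.I (inner ℝ p x : ℝ) p, real_inner_smul_right,
      inner_self_I_smul, mul_zero, sub_zero] at h2
    convert h2 using 1
    abel
  let V : Submodule ℂ H :=
    { carrier := {x | x - (inner ℝ p x : ℝ) • p ∈ T}
      add_mem' := fun {x y} hx hy => hadd x y hx hy
      zero_mem' := by simp
      smul_mem' := fun z x hx => by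
        change z • x - (inner ℝ p (z • x) : ℝ) • p ∈ T
        rw [complex_smul_eq z x]
        exact hadd _ _ (hreal _ _ hx) (hreal _ _ (hI _ hx)) }
  have hV : ∀ x, x ∈ V ↔ x - (inner ℝ p x : ℝ) • p ∈ T := fun x => Iff.rfl
  refine ⟨V, ?_, ?_, fun x => by rw [hV, hT], ?_⟩
  · have hc : Continuous fun x : H => x - (inner ℝ p x : ℝ) • p := by fun_prop
    exact hTc.preimage hc
  · rw [hV, inner_self_of_mem_unitSphere hpS]; simp
  · rintro q ⟨hq, hqV⟩
    obtain ⟨w, hw, hpw, t, -, -, rfl⟩ := exists_greatCircle hpS hq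
    have hsw : Real.sin t • w ∈ T := by
      have h := (hV _).1 hqV
      have e : inner ℝ p (greatCircle p w t) = Real.cos t := by
        have h := inner_cos_sin hpS hw hpw 1 0 (Real.cos t) (Real.sin t)
        rw [greatCircle]
        simpa using h
      rw [e, greatCircle, add_sub_cancel_left] at h
      exact h
    by_cases hs : Real.sin t = 0
    · -- `q = ± p`, which lies on the Reeb orbit of `p`
      have h := hm.greatCircle_mem hN hcl hNS hpos hp ((hT _).1 hreeb) (by
        rw [mem_unitSphere_iff_inner, inner_I_smul_I_smul, inner_self_of_mem_unitSphere hpS]) t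
      simpa [greatCircle, hs] using h
    · have h := T.smul_mem (Real.sin t)⁻¹ hsw
      rw [smul_smul, inv_mul_cancel₀ hs, one_smul] at h
      exact hm.greatCircle_mem hN hcl hNS hpos hp ((hT _).1 h) hw t

end Rotation

/-- A closed connected totally magnetic submanifold of positive dimension is the unit sphere of a
closed complex subspace. -/
theorem IsTotallyMagnetic.exists_eq_inter {N : Set H} (hN : IsEmbeddedSubmanifold N)
    (hcl : IsClosed N) (hNS : N ⊆ unitSphere H)
    (hm : IsTotallyMagnetic (unitSphere H) (dContactForm H) N) (hpos : HasPositiveDimension N)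
    (hconn : IsConnected N) : ∃ V : Submodule ℂ H, N = unitSphere H ∩ V := by
  obtain ⟨p, hp⟩ := hconn.nonempty
  obtain ⟨V, hVc, hpV, hV, hVN⟩ := hm.exists_span hN hcl hNS hpos hp
  refine ⟨V, Subset.antisymm (fun x hx => ⟨hNS hx, ?_⟩) hVN⟩
  -- near each of its points in `V`, the submanifold stays in `V`
  have hlocal : ∀ q ∈ N, q ∈ V → ∀ᶠ x in 𝓝 q, x ∈ N → x ∈ V := by
    intro q hq hqV
    have hqS := hNS hq
    obtain ⟨V', hV'c, hqV', hV', hV'N⟩ := hm.exists_span hN hcl hNS hpos hq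
    have hle : ∀ {a : H} {A B : Submodule ℂ H}, a ∈ unitSphere H → a ∈ A →
        unitSphere H ∩ A ⊆ N →
        (∀ x, x ∈ B ↔ x - (inner ℝ a x : ℝ) • a ∈ tangentVectors N a) → A ≤ B := by
      intro a A B ha haA hA hB x hx
      refine (hB x).2 (mem_tangentVectors_of_subset hA ha haA
        (A.sub_mem hx (A.smul_of_tower_mem _ haA)) ?_)
      rw [inner_sub_right, real_inner_smul_right, inner_self_of_mem_unitSphere ha]
      ring
    have h1 : V ≤ V' := hle hqS hqV hVN hV'
    have h2 : V' ≤ V := hle (hNS hp) (h1 hpV) hV'N hV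
    obtain ⟨L, hL, hLu⟩ := hasStrictFDerivAt_normalize hqS
    let Z : Submodule ℝ H := V'.restrictScalars ℝ
    have : CompleteSpace Z := completeSpace_coe_iff_isComplete.2 hV'c.isComplete
    have he : HasStrictFDerivAt (fun z : Z => ‖q + z‖⁻¹ • (q + (z : H))) (L.comp Z.subtypeL) 0 := by
      have hL' : HasStrictFDerivAt (fun z : H => ‖q + z‖⁻¹ • (q + z)) L (Z.subtypeL 0) := by
        rw [map_zero]; exact hL
      exact hL'.comp (0 : Z) Z.subtypeL.hasStrictFDerivAt
    have he0 : ‖q + ((0 : Z) : H)‖⁻¹ • (q + ((0 : Z) : H)) = q := by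
      simp [mem_unitSphere.1 hqS]
    have hsub : ∀ z : Z, ‖q + z‖⁻¹ • (q + (z : H)) ∈ V' := fun z =>
      V'.smul_of_tower_mem _ (V'.add_mem hqV' z.2)
    have hmem : ∀ᶠ z : Z in 𝓝 0, ‖q + z‖⁻¹ • (q + (z : H)) ∈ N := by
      have hc : Continuous fun z : Z => q + (z : H) := by fun_prop
      have hne : ∀ᶠ z : Z in 𝓝 0, q + (z : H) ≠ 0 := hc.continuousAt.eventually_ne (by
        rw [Submodule.coe_zero, add_zero]
        rintro rfl
        simp [mem_unitSphere] at hqS)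
      filter_upwards [hne] with z hz
      exact hV'N ⟨inv_norm_smul_mem_unitSphere hz, hsub z⟩
    have hev := hN.eventually_mem_range he hmem (fun u hu => by
      rw [he0] at hu
      have hqu := inner_eq_zero_of_mem_tangentVectors hNS hq hu
      have huV : u ∈ V' := (hV' u).2 (by rwa [hqu, zero_smul, sub_zero])
      exact ⟨⟨u, huV⟩, hLu u hqu⟩)
    rw [he0] at hev
    filter_upwards [hev] with x hx hxN
    obtain ⟨z, rfl⟩ := hx hxN
    exact h2 (hsub z)
  have hsplit := isPreconnected_iff_subset_of_disjoint.1 hconn.isPreconnected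
    {q | ∀ᶠ x in 𝓝 q, x ∈ N → x ∈ V} (V : Set H)ᶜ isOpen_setOfPred_eventually_nhds hVc.isOpen_compl
    (fun q hq => by
      by_cases h : q ∈ V
      · exact Or.inl (hlocal q hq h)
      · exact Or.inr h)
    (by
      ext q
      simp only [mem_inter_iff, mem_ofPred_eq, mem_compl_iff, mem_empty_iff_false, iff_false]
      rintro ⟨hq, h1, h2⟩
      exact h2 (h1.self_of_nhds hq))
  rcases hsplit with h | h
  · exact (h hx).self_of_nhds hx
  · exact absurd hpV (h hp)

/-- The unit sphere of a closed complex subspace is totally magnetic: the component of a magnetic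
geodesic orthogonal to the subspace solves a linear equation with zero initial data. -/
theorem isTotallyMagnetic_inter {V : Submodule ℂ H} (hV : IsClosed (V : Set H)) :
    IsTotallyMagnetic (unitSphere H) (dContactForm H) (unitSphere H ∩ V) := by
  intro I γ hI _ h0 hγ hγ0 hγ1
  have : CompleteSpace V := hV.completeSpace_coe
  obtain ⟨P, hP, hPI⟩ : ∃ P : H →L[ℝ] H, (∀ x, P x = 0 ↔ x ∈ V) ∧
      ∀ x, P (Complex.I • x) = Complex.I • P x := by
    refine ⟨(Vᗮ.starProjection).restrictScalars ℝ, fun x => ?_,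
      fun x => Vᗮ.starProjection.map_smul _ x⟩
    rw [ContinuousLinearMap.coe_restrictScalars', Submodule.starProjection_orthogonal_val,
      sub_eq_zero, eq_comm, Submodule.starProjection_eq_self_iff]
  have hdiff : ∀ t ∈ I, HasDerivAt γ (deriv γ t) t := fun t ht =>
    ((hγ.smooth.contDiffAt (hI.mem_nhds ht)).differentiableAt (by simp)).hasDerivAt
  have hsm1 : ContDiffOn ℝ ∞ (deriv γ) I :=
    ((contDiffOn_infty_iff_deriv_of_isOpen hI).1 hγ.smooth).2
  have hsm2 : ContDiffOn ℝ ∞ (deriv (deriv γ)) I :=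
    ((contDiffOn_infty_iff_deriv_of_isOpen hI).1 hsm1).2
  have hdiff2 : ∀ t ∈ I, HasDerivAt (deriv γ) (deriv (deriv γ) t) t := fun t ht =>
    ((hsm1.contDiffAt (hI.mem_nhds ht)).differentiableAt (by simp)).hasDerivAt
  obtain ⟨k, hk⟩ : ∃ k : ℝ → ℝ,
      k = fun t => inner ℝ (γ t) (deriv (deriv γ) t - Complex.I • deriv γ t) := ⟨_, rfl⟩
  have hkc : ContinuousOn k I := by
    rw [hk]
    exact hγ.smooth.continuousOn.inner
      (hsm2.continuousOn.sub (hsm1.continuousOn.const_smul Complex.I))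
  have heq : ∀ t ∈ I, deriv (deriv γ) t = Complex.I • deriv γ t + k t • γ t := fun t ht => by
    rw [hk]; exact hγ.deriv_deriv_eq ht
  obtain ⟨ε, hε, hball⟩ := Metric.nhds_basis_closedBall.mem_iff.1 (hI.mem_nhds h0)
  rw [Real.closedBall_eq_Icc, zero_sub, zero_add] at hball
  obtain ⟨C, hC⟩ := isCompact_Icc.exists_bound_of_continuousOn (hkc.mono hball)
  have hsub : Ioo (-ε) ε ⊆ I := Ioo_subset_Icc_self.trans hball
  have hγ1V : deriv γ 0 ∈ V := by
    rw [← hP]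
    exact apply_eq_zero_of_mem_tangentVectors hγ1 P.hasFDerivAt.hasFDerivWithinAt
      fun x hx => by rw [(hP x).2 hx.2, (hP _).2 hγ0.2]
  have hC0 : 0 ≤ C := (norm_nonneg _).trans (hC 0 ⟨by linarith, hε.le⟩)
  have hode := ODE_solution_unique_of_mem_Ioo (E := H × H) (a := -ε) (b := ε) (t₀ := 0)
    (v := fun t z => (z.2, Complex.I • z.2 + k t • z.1)) (s := fun _ => univ)
    (K := (1 + C).toNNReal) (f := fun t => (P (γ t), P (deriv γ t))) (g := fun _ => 0)
    (fun t ht => by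
      refine LipschitzOnWith.of_dist_le_mul fun x _ y _ => ?_
      rw [Real.coe_toNNReal _ (by linarith), Prod.dist_eq, Prod.dist_eq]
      simp only [dist_eq_norm]
      have e1 := le_max_left ‖x.1 - y.1‖ ‖x.2 - y.2‖
      have e2 := le_max_right ‖x.1 - y.1‖ ‖x.2 - y.2‖
      have e0 := (norm_nonneg _).trans e1
      refine max_le ?_ ?_
      · nlinarith
      · have e3 : Complex.I • x.2 + k t • x.1 - (Complex.I • y.2 + k t • y.1) =
            Complex.I • (x.2 - y.2) + k t • (x.1 - y.1) := by
          rw [smul_sub, smul_sub]; abel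
        have e4 : ‖Complex.I • (x.2 - y.2)‖ = ‖x.2 - y.2‖ := by simp [norm_smul]
        have e5 : ‖k t • (x.1 - y.1)‖ ≤ C * max ‖x.1 - y.1‖ ‖x.2 - y.2‖ := by
          rw [norm_smul]
          exact mul_le_mul (hC t (Ioo_subset_Icc_self ht)) e1 (norm_nonneg _) hC0
        rw [e3]
        refine (norm_add_le _ _).trans ?_
        rw [e4]
        linarith)
    ⟨by linarith, hε⟩
    (fun t ht => by
      refine ⟨?_, mem_univ _⟩
      have d1 := P.hasFDerivAt.comp_hasDerivAt t (hdiff t (hsub ht))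
      have d2 := P.hasFDerivAt.comp_hasDerivAt t (hdiff2 t (hsub ht))
      rw [heq t (hsub ht), P.map_add, hPI, P.map_smul] at d2
      exact d1.prodMk d2)
    (fun t _ => ⟨(hasDerivAt_const t (0 : H × H)).congr_deriv (by simp [Prod.ext_iff]), mem_univ _⟩)
    (by simp [(hP _).2 hγ0.2, (hP _).2 hγ1V])
  refine ⟨ε, hε, hsub, fun t ht => ⟨hγ.mem t (hsub ht), (hP _).1 ?_⟩⟩
  exact congrArg Prod.fst (hode ht)

/-- The unit sphere of a closed complex subspace, inside the ambient sphere, is magnetomorphic to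
the unit sphere of the subspace as a Hilbert space. -/
theorem magnetomorphic_inter {V : Submodule ℂ H} (hV : IsClosed (V : Set H)) :
    Magnetomorphic (unitSphere H ∩ (V : Set H)) (dContactForm H) (unitSphere V)
      (dContactForm V) := by
  have : CompleteSpace V := hV.completeSpace_coe
  let φ : (unitSphere H ∩ (V : Set H) : Set H) ≃ unitSphere V :=
    { toFun := fun x => ⟨⟨x, x.2.2⟩, mem_unitSphere.2 (mem_unitSphere.1 x.2.1)⟩
      invFun := fun y => ⟨y.1, mem_unitSphere.2 (mem_unitSphere.1 y.2), y.1.2⟩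
      left_inv := fun _ => rfl
      right_inv := fun _ => rfl }
  let P : H →L[ℝ] V := V.orthogonalProjectionOnto.restrictScalars ℝ
  let J : V →L[ℝ] H := V.subtypeL.restrictScalars ℝ
  have hφ : EqOn (ambientMap φ) P (unitSphere H ∩ (V : Set H)) := by
    intro x hx
    rw [ambientMap_apply φ ⟨x, hx⟩]
    exact (V.orthogonalProjectionOnto_mem_subspace_eq_self ⟨x, hx.2⟩).symm
  have hφ' : EqOn (ambientMap φ.symm) J (unitSphere V) := by
    intro x hx
    rw [ambientMap_apply φ.symm ⟨x, hx⟩]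
    rfl
  have hT : ∀ p ∈ unitSphere H ∩ (V : Set H), ∀ u ∈ tangentVectors (unitSphere H ∩ (V : Set H)) p,
      ((tangentMap φ p u : V) : H) = u := by
    intro p hp u hu
    have h1 : tangentMap φ p u = P u := fderivWithin_apply_of_eqOn hp hu P hφ
    have h2 := apply_eq_zero_of_mem_tangentVectors hu
      ((J.comp P - ContinuousLinearMap.id ℝ H).hasFDerivAt.hasFDerivWithinAt) (fun x hx => by
        have hfix : ∀ y ∈ V, (J.comp P - ContinuousLinearMap.id ℝ H) y = 0 := fun y hy =>
          sub_eq_zero.2 (V.starProjection_eq_self_iff.2 hy)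
        rw [hfix x hx.2, hfix p hp.2])
    rw [h1]
    exact sub_eq_zero.1 h2
  refine ⟨φ, P.contDiff.contDiffOn.congr hφ, J.contDiff.contDiffOn.congr hφ',
    fun p u hu v hv => ?_, fun p u hu v hv => ?_⟩
  · have h : inner ℝ ((tangentMap φ p u : V) : H) ((tangentMap φ p v : V) : H) = inner ℝ u v := by
      rw [hT p p.2 u hu, hT p p.2 v hv]
    exact h
  · have h : inner ℝ (Complex.I • ((tangentMap φ p u : V) : H)) ((tangentMap φ p v : V) : H) =
        inner ℝ (Complex.I • u) v := by
      rw [hT p p.2 u hu, hT p p.2 v hv]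
    rw [dContactForm_apply, dContactForm_apply]
    exact h

end Subspheres

end Magnetic

open Magnetic

theorem mainTheorem5 :
    (∃ e : Magnetic.UnitaryGroup Magnetic.L2Circle ≃*
        Magnetic.magGroup (Magnetic.unitSphere Magnetic.L2Circle)
          (Magnetic.dContactForm Magnetic.L2Circle),
      (∀ (U : Magnetic.UnitaryGroup Magnetic.L2Circle)
          (f : Magnetic.unitSphere Magnetic.L2Circle),
        (((e U : Equiv.Perm (Magnetic.unitSphere Magnetic.L2Circle)) f) : Magnetic.L2Circle) =
          (U : Magnetic.L2Circle →L[ℂ] Magnetic.L2Circle) (f : Magnetic.L2Circle)) ∧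
      Magnetic.IsSymplecticOn
        (Magnetic.tangentBundle (Magnetic.unitSphere Magnetic.L2Circle))
        (Magnetic.twistedForm (Magnetic.dContactForm Magnetic.L2Circle)) ∧
      ∃ μ : Magnetic.L2Circle × Magnetic.L2Circle →
          (Magnetic.UnitaryLieAlgebra Magnetic.L2Circle →L[ℝ] ℝ),
        (∀ f F : Magnetic.L2Circle,
          (f, F) ∈ Magnetic.tangentBundle (Magnetic.unitSphere Magnetic.L2Circle) →
          ∀ A : Magnetic.UnitaryLieAlgebra Magnetic.L2Circle,
            μ (f, F) A =
              (inner ℂ ((A : Magnetic.L2Circle →L[ℂ] Magnetic.L2Circle) f) F).re -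
                Magnetic.contactForm Magnetic.L2Circle f
                  ((A : Magnetic.L2Circle →L[ℂ] Magnetic.L2Circle) f)) ∧
        Magnetic.IsHamiltonianAction
          (Magnetic.tangentBundle (Magnetic.unitSphere Magnetic.L2Circle))
          (Magnetic.twistedForm (Magnetic.dContactForm Magnetic.L2Circle))
          (fun U => Magnetic.tangentLift
            (e U : Equiv.Perm (Magnetic.unitSphere Magnetic.L2Circle)))
          μ) ∧
    (∀ N : Set Magnetic.L2Circle, N ⊆ Magnetic.unitSphere Magnetic.L2Circle →
      Magnetic.IsEmbeddedSubmanifold N → IsClosed N → IsConnected N →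
      Magnetic.HasPositiveDimension N →
      ((Magnetic.IsTotallyMagnetic (Magnetic.unitSphere Magnetic.L2Circle)
          (Magnetic.dContactForm Magnetic.L2Circle) N ↔
        ∃ V : Submodule ℂ Magnetic.L2Circle,
          N = Magnetic.unitSphere Magnetic.L2Circle ∩ (V : Set Magnetic.L2Circle)) ∧
      ∀ V : Submodule ℂ Magnetic.L2Circle,
        N = Magnetic.unitSphere Magnetic.L2Circle ∩ (V : Set Magnetic.L2Circle) →
        IsClosed (V : Set Magnetic.L2Circle) ∧
        Magnetic.Magnetomorphic N (Magnetic.dContactForm Magnetic.L2Circle)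
          (Magnetic.unitSphere V) (Magnetic.dContactForm V))) := by
  refine ⟨⟨unitaryEquivMagGroup L2Circle.exists_orthogonal, fun U f => rfl,
    isSymplecticOn_twistedForm, momentMap, fun f F _ A => ?_, isHamiltonianAction_sphereAction⟩,
    fun N hNS hN hcl hconn hpos => ⟨⟨fun hm => hm.exists_eq_inter hN hcl hNS hpos hconn, ?_⟩, ?_⟩⟩
  · rw [momentMap_apply, real_inner_comm]
    rfl
  · rintro ⟨V, rfl⟩
    exact isTotallyMagnetic_inter (isClosed_of_isClosed_inter hcl)
  · rintro V rfl
    have hV := isClosed_of_isClosed_inter hcl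
    exact ⟨hV, magnetomorphic_inter hV⟩
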